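/- **RAN-crystals.** Let $n\ge 1$. An $n$-colored digraph $K$ is a digraph with vertex set $V$ whose edge set is divided into color classes $E_1,\dots,E_n$. Assume that (A1) for each $i$, every connected component of $(V,E_i)$ is a simple finite directed path (an *$i$-line*). Then each $E_i$ defines a partial injective operator $F_i$ on $V$ ($F_i(u)=v$ iff $(u,v)\in E_i$). Let $t_i(v)$ and $h_i(v)$ be the lengths of the parts of the $i$-line through $v$ from its beginning to $v$ and from $v$ to its end. An operator equality below includes the claim that all edges involved exist, and operators $F,F'$ *commute* at $v$ if both act at $v$ and $FF'(v)=F'F(v)$. An *RAN-crystal* (regular $A_n$-crystal) is a nonempty weakly connected $n$-colored digraph satisfying (A1) and: (A2) For $i\ne j$ and each $i$-edge $(u,v)$: $t_j(v)\le t_j(u)$, $h_j(v)\ge h_j(u)$, and $(t_j(v)-t_j(u))+(h_j(u)-h_j(v))$ equals $-1$ if $|i-j|=1$ and $0$ otherwise. If $(u,v),(v,w)$ are consecutive $i$-edges, then $h_j(u)+h_j(w)\ge 2h_j(v)$. For $|i-j|=1$, the critical vertex of an $i$-line with respect to $j$ is the (unique) vertex $r$ of it such that every edge $(u,v)$ of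 the line before $r$ has $t_j(v)=t_j(u)-1$, $h_j(v)=h_j(u)$, and every edge $(u,v)$ after $r$ has $t_j(v)=t_j(u)$, $h_j(v)=h_j(u)+1$. The label $\ell_j(e)$ of an $i$-edge $e$ is $0$ if $e$ lies before the critical vertex of its $i$-line, and $1$ otherwise. (A3) Let $|i-j|=1$. (a) If $u$ has outgoing $i$-edge $(u,v)$ and outgoing $j$-edge $(u,v')$ and $\ell_j(u,v)=0$, then $\ell_i(u,v')=1$ and $F_iF_j(u)=F_jF_i(u)$. (b) If $v$ has incoming $i$-edge $(u,v)$ and incoming $j$-edge $(u',v)$ and $\ell_j(u,v)=1$, then $\ell_i(u',v)=0$ and $F_i^{-1}F_j^{-1}(v)=F_j^{-1}F_i^{-1}(v)$. (A4) Let $|i-j|=1$. (i) If $u$ has outgoing edges of colors $i$ and $j$, both labeled $1$ (each with respect to the other color), then $F_iF_j^2F_i(u)=F_jF_i^2F_j(u)$. (ii) If $v$ has incoming edges of colors $i$ and $j$, both labeled $0$, then $F_i^{-1}F_j^{-2}F_i^{-1}(v)=F_j^{-1}F_i^{-2}F_j^{-1}(v)$. (A5) If $|i-j|\ge2$, then any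 $F\in\{F_i,F_i^{-1}\}$ and $F'\in\{F_j,F_j^{-1}\}$ commute at each vertex where both act. **The crossing model.** The supporting graph $G$ has nodes $v_i^k(j)$ for $1\le j\le i\le n$ and $i-j+1\le k\le n-j+1$. Its edges are all pairs of nodes of the form $(v_i^k(j),v_{i-1}^k(j))$ (ascending) or $(v_i^k(j),v_{i+1}^k(j+1))$ (descending). $G^k$ is the subgraph on the nodes with upper index $k$, and the multinode $V_i(j)$ is the set of nodes $v_i^k(j)$, ordered by increasing $k$. The NW- and SW-edges of a node $v$ are its incoming descending and incoming ascending edge, and its SE-edge is its outgoing descending edge. For a function $f$ on nodes and an edge $e=(u,v)$ put $\partial f(e)=f(u)-f(v)$; $e$ is tight if $\partial f(e)=0$. A node $v\in V_i(j)$ satisfies the switch condition if the SE-edges of all nodes of $V_i(j)$ preceding $v$ and the SW-edges of all nodes of $V_i(j)$ succeeding $v$ are tight. Let $\mathbf c=(c_1,\dots,c_n)\in\mathbb Z_{\ge0}^n$. The set $\mathcal F(\mathbf c)$ of feasible functions consists of all $f:V(G)\to\mathbb Z$ such that (i) $\partial f(e)\ge 0$ for all edges $e$; (ii) $0\le f(v)\le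 c_k$ for $v\in V(G^k)$; (iii) each multinode contains a node satisfying the switch condition. Extend $G$ by allowing as nodes $v_i^k(j)$, for each $k=1,\dots,n$, all $(i,j)$ with $0\le i,j\le n+1$, $j\le i+1$, $(i,j)\ne(n+1,0)$, with edges of the same two forms, and denote by $\overline V_i(j)$ the extended multinode $\{v_i^1(j),\dots,v_i^n(j)\}$. Extend $f\in\mathcal F(\mathbf c)$ by $f(v_i^k(j))=c_k$ if $j=0$ or $i-j>k-1$, and $f(v_i^k(j))=0$ if $j>i$ or $j>n-k+1$. Put $$\epsilon_i(j)=\sum_{k=1}^n\bigl(f(v^k_{i-1}(j-1))-f(v^k_i(j))\bigr),\qquad \delta_i(j)=\sum_{k=1}^n\bigl(f(v^k_i(j))-f(v^k_{i+1}(j+1))\bigr),$$ $$\pi_i(p,q)=\sum_{r=p+1}^q\epsilon_i(r)-\sum_{r=p}^{q-1}\delta_i(r)\qquad(0\le p<q\le i+1),$$ $$\widetilde\epsilon_i(j)=\max\{0,\min_{0\le p<j}\pi_i(p,j)\}\ (1\le j\le i+1),\qquad \widetilde\delta_i(j)=\max\{0,\min_{j<q\le i+1}(-\pi_i(j,q))\}\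 (0\le j\le i).$$ Given a level $i\in\{1,\dots,n\}$, let $j$ be the minimum element of $\{1,\dots,i\}$ with $\widetilde\delta_i(0)=\dots=\widetilde\delta_i(j-1)=0$ and $\widetilde\epsilon_i(j+1)=\dots=\widetilde\epsilon_i(i+1)=0$. If $\widetilde\epsilon_i(j)>0$, then $\overline V_i(j)$ is the active multinode of level $i$, the move $\phi_i$ is applicable to $f$, and $\phi_i(f)$ is obtained from (the extended) $f$ by adding $1$ to its value at the first node of $\overline V_i(j)$ satisfying the switch condition in the extended graph. Otherwise level $i$ has no active multinode and $\phi_i$ is not applicable to $f$. **Theorem.** For every $n\ge1$ and every $\mathbf c\in\mathbb Z_{\ge0}^n$, whenever $\phi_i$ is applicable to $f\in\mathcal F(\mathbf c)$, the function $\phi_i(f)$ is again (the extension of) a function in $\mathcal F(\mathbf c)$; and the $n$-colored digraph $\mathcal K(\mathbf c)$ with vertex set $\mathcal F(\mathbf c)$ and with $i$-edges $(f,\phi_i(f))$, for all $i=1,\dots,n$ and all $f\in\mathcal F(\mathbf c)$ to which $\phi_i$ is applicable, is an RAN-crystal. -/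

import Mathlib

/-! ### Edge-colored digraphs and the axioms of RAN-crystals -/

/-- An `n`-colored digraph with vertex set `V`: `K.Edge i u v` says that there is an edge of
color `i` from `u` to `v`. The colors `1, …, n` are represented by the elements of `Fin n`. -/
structure ColoredDigraph (n : ℕ) (V : Type*) where
  Edge : Fin n → V → V → Prop

namespace ColoredDigraph

variable {n : ℕ} {V : Type*} (K : ColoredDigraph n V)

/-- (Weak) connectedness; the empty digraph does not count as connected. -/
def Connected : Prop :=
  Nonempty V ∧ ∀ u v : V, Relation.EqvGen (fun a b => ∃ i, K.Edge i a b) u v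

/-- (A1): the component of every vertex `v` in the monochromatic digraph `(V, E_i)` is a simple
finite path `p 0, …, p k`: the vertices are distinct, they are all the vertices of the component,
and the `i`-edges of the component are exactly the `k` edges of the path. -/
def AxiomA1 : Prop :=
  ∀ (i : Fin n) (v : V), ∃ (k : ℕ) (p : Fin (k + 1) → V),
    Function.Injective p ∧
    (∀ u, Relation.EqvGen (K.Edge i) v u ↔ u ∈ Set.range p) ∧
    (∀ u w, Relation.EqvGen (K.Edge i) v u →
      (K.Edge i u w ↔ ∃ m : Fin k, u = p m.castSucc ∧ w = p m.succ))

/-- `h_i(v)`: the length of the part of the `i`-line through `v` that begins at `v`, i.e. the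
maximum length of a path of `i`-edges beginning at `v`. -/
noncomputable def headLen (i : Fin n) (v : V) : ℕ :=
  sSup {k : ℕ | ∃ p : ℕ → V, p 0 = v ∧ ∀ m < k, K.Edge i (p m) (p (m + 1))}

/-- `t_i(v)`: the length of the part of the `i`-line through `v` that ends at `v`, i.e. the
maximum length of a path of `i`-edges ending at `v`. -/
noncomputable def tailLen (i : Fin n) (v : V) : ℕ :=
  sSup {k : ℕ | ∃ p : ℕ → V, p k = v ∧ ∀ m < k, K.Edge i (p m) (p (m + 1))}

/-- (A2), where `CartanMatrix.A n` is the Cartan matrix of type `A_n`. -/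
def AxiomA2 : Prop :=
  ∀ i j : Fin n, i ≠ j →
    (∀ u v, K.Edge i u v →
      K.tailLen j v ≤ K.tailLen j u ∧ K.headLen j u ≤ K.headLen j v ∧
      ((K.tailLen j v : ℤ) - K.tailLen j u) + ((K.headLen j u : ℤ) - K.headLen j v)
        = CartanMatrix.A n i j) ∧
    (∀ u v w, K.Edge i u v → K.Edge i v w →
      2 * K.headLen j v ≤ K.headLen j u + K.headLen j w)

/-- Neighboring colors: `|i - j| = 1`. -/
def Neighboring (i j : Fin n) : Prop := |((i : ℕ) : ℤ) - ((j : ℕ) : ℤ)| = 1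

/-- `r` is the critical vertex, with respect to the color `j`, of the `i`-line through `r`:
each `i`-edge of this line before `r` decreases `t_j` by one and keeps `h_j`, and each `i`-edge
of this line after `r` keeps `t_j` and increases `h_j` by one. -/
def IsCritical (i j : Fin n) (r : V) : Prop :=
  (∀ u v, K.Edge i u v → Relation.ReflTransGen (K.Edge i) v r →
    K.tailLen j u = K.tailLen j v + 1 ∧ K.headLen j v = K.headLen j u) ∧
  (∀ u v, Relation.ReflTransGen (K.Edge i) r u → K.Edge i u v →
    K.tailLen j v = K.tailLen j u ∧ K.headLen j v = K.headLen j u + 1)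

open Classical in
/-- The label `ℓ_j(e)` of an `i`-edge `e = (u, v)`: it is `0` if `e` occurs in its `i`-line
before the critical vertex of this line with respect to `j`, and `1` otherwise. -/
noncomputable def label (i j : Fin n) (u v : V) : ℕ :=
  if K.Edge i u v ∧ ∃ r, K.IsCritical i j r ∧ Relation.ReflTransGen (K.Edge i) v r then 0 else 1

/-- The partial operators `F_i` (for `fwd = true`) and `F_i⁻¹` (for `fwd = false`), as relations. -/
def Op (i : Fin n) (fwd : Bool) (u v : V) : Prop :=
  match fwd with
  | true => K.Edge i u v
  | false => K.Edge i v u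

/-- The operators `F_i^{±1}` and `F_j^{±1}` commute at `v`: both act at `v`, both compositions
are defined at `v`, and their values coincide. -/
def CommuteAt (i : Fin n) (a : Bool) (j : Fin n) (b : Bool) (v : V) : Prop :=
  (∃ x, K.Op i a v x) ∧ (∃ y, K.Op j b v y) ∧
  ∃ w, Relation.Comp (K.Op j b) (K.Op i a) v w ∧ Relation.Comp (K.Op i a) (K.Op j b) v w

/-- The Verma relation of degree 4 at `v`: with `F = F_i`, `F' = F_j` (or their inverses, if
`a = false`), both `F F' F' F` and `F' F F F'` are defined at `v`, with the same value. -/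
def VermaAt (i j : Fin n) (a : Bool) (v : V) : Prop :=
  ∃ w,
    Relation.Comp (K.Op i a) (Relation.Comp (K.Op j a)
      (Relation.Comp (K.Op j a) (K.Op i a))) v w ∧
    Relation.Comp (K.Op j a) (Relation.Comp (K.Op i a)
      (Relation.Comp (K.Op i a) (K.Op j a))) v w

/-- (A3). -/
def AxiomA3 : Prop :=
  ∀ i j : Fin n, Neighboring i j →
    (∀ u v v', K.Edge i u v → K.Edge j u v' → K.label i j u v = 0 →
      K.label j i u v' = 1 ∧ K.CommuteAt i true j true u) ∧
    (∀ v u u', K.Edge i u v → K.Edge j u' v → K.label i j u v = 1 →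
      K.label j i u' v = 0 ∧ K.CommuteAt i false j false v)

/-- (A4). -/
def AxiomA4 : Prop :=
  ∀ i j : Fin n, Neighboring i j →
    (∀ u v v', K.Edge i u v → K.Edge j u v' → K.label i j u v = 1 → K.label j i u v' = 1 →
      K.VermaAt i j true u) ∧
    (∀ v u u', K.Edge i u v → K.Edge j u' v → K.label i j u v = 0 → K.label j i u' v = 0 →
      K.VermaAt i j false v)

/-- (A5). -/
def AxiomA5 : Prop :=
  ∀ i j : Fin n, 2 ≤ |((i : ℕ) : ℤ) - ((j : ℕ) : ℤ)| → ∀ (a b : Bool) (v : V),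
    (∃ x, K.Op i a v x) → (∃ y, K.Op j b v y) → K.CommuteAt i a j b v

/-- A regular `A_n`-crystal (RAN-crystal): a connected `n`-colored digraph with (A1)–(A5). -/
structure IsRANCrystal : Prop where
  connected : K.Connected
  a1 : K.AxiomA1
  a2 : K.AxiomA2
  a3 : K.AxiomA3
  a4 : K.AxiomA4
  a5 : K.AxiomA5

end ColoredDigraph

/-! ### The crossing model -/

namespace CrossingModel

/-- The nodes of the supporting graph `G`. The element `k : Fin n` stands for the upper index
`k + 1 ∈ {1, …, n}`, while `i` (the level) and `j` are counted from one. So this node is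
`v_i^{k+1}(j)`, with `1 ≤ j ≤ i ≤ n` and `i - j + 1 ≤ k + 1 ≤ n - j + 1`. -/
@[ext]
structure Node (n : ℕ) where
  k : Fin n
  i : ℕ
  j : ℕ
  one_le_j : 1 ≤ j
  j_le_i : j ≤ i
  i_le : i ≤ j + k
  le_n : j + k ≤ n

variable {n : ℕ}

/-- `(u, v)` is an ascending edge `(v_i^k(j), v_{i-1}^k(j))` of `G`. -/
def IsAscending (u v : Node n) : Prop := u.k = v.k ∧ u.i = v.i + 1 ∧ u.j = v.j

/-- `(u, v)` is a descending edge `(v_i^k(j), v_{i+1}^k(j+1))` of `G`. -/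
def IsDescending (u v : Node n) : Prop := u.k = v.k ∧ v.i = u.i + 1 ∧ v.j = u.j + 1

/-- The switch condition for `v` in its multinode `V_i(j)`: the SE-edge of every node of `V_i(j)`
preceding `v` and the SW-edge of every node of `V_i(j)` succeeding `v` are tight. -/
def SwitchCondition (f : Node n → ℤ) (v : Node n) : Prop :=
  (∀ u : Node n, u.i = v.i → u.j = v.j → u.k < v.k → ∃ w, IsDescending u w ∧ f u = f w) ∧
  (∀ u : Node n, u.i = v.i → u.j = v.j → v.k < u.k → ∃ w, IsAscending w u ∧ f w = f u)

/-- Feasible functions on the nodes of `G`, for the parameter `c`. -/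
structure IsFeasible (c : Fin n → ℕ) (f : Node n → ℤ) : Prop where
  monotone : ∀ u v : Node n, IsAscending u v ∨ IsDescending u v → f v ≤ f u
  bounds : ∀ v : Node n, 0 ≤ f v ∧ f v ≤ c v.k
  switch : ∀ i j : ℕ, 1 ≤ j → j ≤ i → i ≤ n →
    ∃ v : Node n, v.i = i ∧ v.j = j ∧ SwitchCondition f v

/-- The set `𝓕(c)` of feasible functions. -/
def Feasible (c : Fin n → ℕ) : Type := {f : Node n → ℤ // IsFeasible c f}

/-- The extension of a function on `G` to the extended supporting graph: it is `c_k` on the extra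
nodes to the left of `G^k`, and `0` on the extra nodes to the right of `G^k`. A function on the
extended graph takes the upper index `k`, the level `i` and the index `j` as arguments; its values
outside the range of the indices of the extended graph play no role. -/
def extend (c : Fin n → ℕ) (f : Node n → ℤ) (k : Fin n) (i j : ℕ) : ℤ :=
  if h : 1 ≤ j ∧ j ≤ i ∧ i ≤ j + k ∧ j + k ≤ n then f ⟨k, i, j, h.1, h.2.1, h.2.2.1, h.2.2.2⟩
  else if j = 0 ∨ j + k < i then c k else 0

/-! In what follows `g` is a function on the extended supporting graph. -/

/-- The upper slack `ε_i(j)` at a multinode (for `i, j ≥ 1`). -/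
def upperSlack (g : Fin n → ℕ → ℕ → ℤ) (i j : ℕ) : ℤ :=
  ∑ k : Fin n, (g k (i - 1) (j - 1) - g k i j)

/-- The lower slack `δ_i(j)` at a multinode. -/
def lowerSlack (g : Fin n → ℕ → ℕ → ℤ) (i j : ℕ) : ℤ :=
  ∑ k : Fin n, (g k i j - g k (i + 1) (j + 1))

/-- `π(p, q) = ∑_{r=p+1}^{q} ε_i(r) - ∑_{r=p}^{q-1} δ_i(r)`, for `0 ≤ p < q ≤ i + 1`. -/
def slackDiff (g : Fin n → ℕ → ℕ → ℤ) (i p q : ℕ) : ℤ :=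
  ∑ r ∈ Finset.Icc (p + 1) q, upperSlack g i r - ∑ r ∈ Finset.Ico p q, lowerSlack g i r

/-- The residual upper slack `max {0, min {π(p, j) : 0 ≤ p < j}}`, for `1 ≤ j ≤ i + 1`. -/
noncomputable def residualUpper (g : Fin n → ℕ → ℕ → ℤ) (i j : ℕ) : ℤ :=
  max 0 (⨅ p : Fin j, slackDiff g i p j)

/-- The residual lower slack `max {0, min {-π(j, q) : j < q ≤ i + 1}}`, for `0 ≤ j ≤ i`. -/
noncomputable def residualLower (g : Fin n → ℕ → ℕ → ℤ) (i j : ℕ) : ℤ :=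
  max 0 (⨅ q : Set.Ioc j (i + 1), -slackDiff g i j q)

/-- In level `i`, the residual lower slacks vanish at `0, …, j - 1` and the residual upper slacks
vanish at `j + 1, …, i + 1`. -/
def Separates (g : Fin n → ℕ → ℕ → ℤ) (i j : ℕ) : Prop :=
  (∀ r < j, residualLower g i r = 0) ∧ (∀ r, j < r → r ≤ i + 1 → residualUpper g i r = 0)

/-- The multinode with index `j` is active in level `i`: `j` is the minimum element of
`{1, …, i}` that separates, and its residual upper slack is positive. -/
def IsActive (g : Fin n → ℕ → ℕ → ℤ) (i j : ℕ) : Prop :=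
  1 ≤ j ∧ j ≤ i ∧ Separates g i j ∧ (∀ j', 1 ≤ j' → j' < j → ¬ Separates g i j') ∧
    0 < residualUpper g i j

/-- The switch condition in the extended graph for the node with upper index `k`. -/
def ExtSwitchCondition (g : Fin n → ℕ → ℕ → ℤ) (i j : ℕ) (k : Fin n) : Prop :=
  (∀ k' < k, g k' i j = g k' (i + 1) (j + 1)) ∧ (∀ k', k < k' → g k' (i + 1) j = g k' i j)

/-- The switch-node is the first node of the multinode satisfying the switch condition. -/
def IsSwitchNode (g : Fin n → ℕ → ℕ → ℤ) (i j : ℕ) (k : Fin n) : Prop :=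
  ExtSwitchCondition g i j k ∧ ∀ k' < k, ¬ ExtSwitchCondition g i j k'

/-- The moving operator `φ_i` is applicable to `g`: level `i` has an active multinode. -/
def MoveApplicable (i : ℕ) (g : Fin n → ℕ → ℕ → ℤ) : Prop := ∃ j, IsActive g i j

/-- `g' = φ_i(g)`: level `i` has an active multinode, and `g'` arises from `g` by increasing by
one the value at the switch-node of the active multinode. -/
def IsMove (i : ℕ) (g g' : Fin n → ℕ → ℕ → ℤ) : Prop :=
  ∃ (j : ℕ) (k : Fin n), IsActive g i j ∧ IsSwitchNode g i j k ∧
    ∀ k' i' j', g' k' i' j' = if k' = k ∧ i' = i ∧ j' = j then g k' i' j' + 1 else g k' i' j'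

/-- The `n`-colored digraph `𝓚(c)`: its vertices are the feasible functions, and its edges of
color `i` are the pairs `(f, φ_i(f))`. The color `i : Fin n` corresponds to the level `i + 1`. -/
def crystal (c : Fin n → ℕ) : ColoredDigraph n (Feasible c) where
  Edge i f f' := IsMove ((i : ℕ) + 1) (extend c f.1) (extend c f'.1)

end CrossingModel

/-! Summing a feasible function over each extended multinode gives a Gelfand–Tsetlin pattern `x`
with boundary values fixed by `c`. The switch condition makes this a bijection onto such patterns:
once level `i + 1` is known, the admissible value vectors on a multinode of level `i` form a chain,
so their sum singles one out (`IsExtFeasible.eq_of_multinodeSum_eq`,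
`IsPattern.exists_isExtFeasible`).

On patterns the residual slacks disappear. With `pot x i q` the cumulative slack difference π(0, q)
of level `i + 1`, the active multinode is the first maximizer `j ≥ 1` of `pot x i` (`isActive_iff`),
and the move adds 1 to the entry `(i + 1, j)` (`crystal_edge_iff`). That the move preserves
feasibility is `IsExtFeasible.raise`. After the move `j` is the last maximizer, so moves are
invertible. The distance to the end of a line is the maximum of `pot x i`; the distance from its
beginning is the maximum minus the final value.

A move at `a` shifts the potentials of the two neighboring levels by one on a final segment starting
just after `a` or at `a`, and leaves those of remote levels alone. Hence (A2)–(A5) become statements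
about first and last maximizers of two integer sequences under such shifts (`heights_below`,
`heights_above`, the `commute_of_…` lemmas, `verma_forward`, `verma_backward`).

Connectedness: moves strictly increase a bounded sum of entries, so every vertex leads to a sink,
and the inequalities `pot x i q ≤ 0` at a sink force every column to be constant from the diagonal
down to the boundary, so the sink is unique. -/

namespace ColoredDigraph

/-! ### Line lengths, (A1) and labels for an abstract colored digraph with height functions. -/

variable {n : ℕ} {V : Type*} {K : ColoredDigraph n V}

/-- Families `h`, `t` of functions that measure the distances to the end and from the beginning
of the monochromatic lines of a digraph whose monochromatic edges are partial injections. -/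
structure IsHeight (K : ColoredDigraph n V) (h t : Fin n → V → ℕ) : Prop where
  unique_out : ∀ {i u v v'}, K.Edge i u v → K.Edge i u v' → v = v'
  unique_in : ∀ {i u u' v}, K.Edge i u v → K.Edge i u' v → u = u'
  head_edge : ∀ {i u v}, K.Edge i u v → h i u = h i v + 1
  head_pos : ∀ {i u}, 0 < h i u → ∃ v, K.Edge i u v
  tail_edge : ∀ {i u v}, K.Edge i u v → t i v = t i u + 1
  tail_pos : ∀ {i v}, 0 < t i v → ∃ u, K.Edge i u v

namespace IsHeight

variable {h t : Fin n → V → ℕ}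

theorem head_add (H : IsHeight K h t) {i : Fin n} {p : ℕ → V} {k : ℕ}
    (hp : ∀ m < k, K.Edge i (p m) (p (m + 1))) : h i (p 0) = h i (p k) + k := by
  induction k with
  | zero => simp
  | succ k ih =>
    have h1 := ih fun m hm => hp m (by omega)
    have h2 := H.head_edge (hp k (by omega))
    omega

theorem tail_add (H : IsHeight K h t) {i : Fin n} {p : ℕ → V} {k : ℕ}
    (hp : ∀ m < k, K.Edge i (p m) (p (m + 1))) : t i (p k) = t i (p 0) + k := by
  induction k with
  | zero => simp
  | succ k ih =>
    have h1 := ih fun m hm => hp m (by omega)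
    have h2 := H.tail_edge (hp k (by omega))
    omega

theorem exists_path_from (H : IsHeight K h t) (i : Fin n) (k : ℕ) :
    ∀ v, k ≤ h i v → ∃ p : ℕ → V, p 0 = v ∧ ∀ m < k, K.Edge i (p m) (p (m + 1)) := by
  induction k with
  | zero => exact fun v _ => ⟨fun _ => v, rfl, by simp⟩
  | succ k ih =>
    intro v hv
    obtain ⟨w, hw⟩ := H.head_pos (i := i) (u := v) (by omega)
    obtain ⟨p, hp0, hp⟩ := ih w (by have := H.head_edge hw; omega)
    refine ⟨fun m => m.casesOn v p, rfl, fun m hm => ?_⟩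
    cases m with
    | zero => simpa [hp0] using hw
    | succ m => exact hp m (by omega)

theorem exists_path_to (H : IsHeight K h t) (i : Fin n) (k : ℕ) :
    ∀ v, k ≤ t i v → ∃ p : ℕ → V, p k = v ∧ ∀ m < k, K.Edge i (p m) (p (m + 1)) := by
  induction k with
  | zero => exact fun v _ => ⟨fun _ => v, rfl, by simp⟩
  | succ k ih =>
    intro v hv
    obtain ⟨w, hw⟩ := H.tail_pos (i := i) (v := v) (by omega)
    obtain ⟨p, hpk, hp⟩ := ih w (by have := H.tail_edge hw; omega)
    refine ⟨fun m => if m ≤ k then p m else v, by simp, fun m hm => ?_⟩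
    rcases Nat.lt_succ_iff_lt_or_eq.1 hm with hlt | rfl
    · simpa [hlt.le, Nat.succ_le_of_lt hlt] using hp m hlt
    · simpa [hpk] using hw

/-- The lengths of paths from `v` fill exactly the interval up to `h i v`, so the supremum is that
of a bounded set and not a default value. -/
theorem headLen_eq (H : IsHeight K h t) (i : Fin n) (v : V) : K.headLen i v = h i v := by
  have : {k : ℕ | ∃ p : ℕ → V, p 0 = v ∧ ∀ m < k, K.Edge i (p m) (p (m + 1))}
      = Set.Iic (h i v) := by
    ext k
    refine ⟨?_, fun hk => H.exists_path_from i k v hk⟩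
    rintro ⟨p, rfl, hp⟩
    have := H.head_add hp
    simp only [Set.mem_Iic]
    omega
  rw [headLen, this, csSup_Iic]

theorem tailLen_eq (H : IsHeight K h t) (i : Fin n) (v : V) : K.tailLen i v = t i v := by
  have : {k : ℕ | ∃ p : ℕ → V, p k = v ∧ ∀ m < k, K.Edge i (p m) (p (m + 1))}
      = Set.Iic (t i v) := by
    ext k
    refine ⟨?_, fun hk => H.exists_path_to i k v hk⟩
    rintro ⟨p, rfl, hp⟩
    have := H.tail_add hp
    simp only [Set.mem_Iic]
    omega
  rw [tailLen, this, csSup_Iic]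

/-- Go back from `v` to a vertex with `t = 0`, then forward as far as possible. Along this path `t`
is the position, so its vertices are distinct. -/
theorem axiomA1 (H : IsHeight K h t) : K.AxiomA1 := by
  intro i v
  obtain ⟨q, hqv, hq⟩ := H.exists_path_to i _ v le_rfl
  have hq0 : t i (q 0) = 0 := by
    have := H.tail_add hq
    rw [hqv] at this
    omega
  obtain ⟨p, hp0, hp⟩ := H.exists_path_from i _ (q 0) le_rfl
  have htail : ∀ m ≤ h i (q 0), t i (p m) = m := by
    intro m hm
    have := H.tail_add (p := p) (k := m) fun l hl => hp l (by omega)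
    rw [hp0, hq0] at this
    omega
  -- The path has no exits: an edge leaving `p m` forces `m` to be below the final index, an edge
  -- entering it forces `m > 0`, and uniqueness identifies it with a path edge.
  have hclosed : ∀ u w, K.Edge i u w →
      ((∃ m ≤ h i (q 0), u = p m) ↔ ∃ m ≤ h i (q 0), w = p m) := by
    intro u w huw
    constructor
    · rintro ⟨m, hm, rfl⟩
      have h1 := H.head_add (p := p) (k := m) fun l hl => hp l (by omega)
      have h2 := H.head_edge huw
      rw [hp0] at h1
      exact ⟨m + 1, by omega, H.unique_out huw (hp m (by omega))⟩
    · rintro ⟨m, hm, rfl⟩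
      have h1 := htail m hm
      have h2 := H.tail_edge huw
      obtain ⟨l, rfl⟩ : ∃ l, m = l + 1 := ⟨m - 1, by omega⟩
      exact ⟨l, by omega, H.unique_in huw (hp l (by omega))⟩
  have heqv : ∀ u w, Relation.EqvGen (K.Edge i) u w →
      ((∃ m ≤ h i (q 0), u = p m) ↔ ∃ m ≤ h i (q 0), w = p m) := by
    intro u w huw
    induction huw with
    | rel _ _ e => exact hclosed _ _ e
    | refl => exact Iff.rfl
    | symm _ _ _ ih => exact ih.symm
    | trans _ _ _ _ _ ih1 ih2 => exact ih1.trans ih2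
  have hpath : ∀ (r : ℕ → V) (k : ℕ), (∀ m < k, K.Edge i (r m) (r (m + 1))) →
      Relation.EqvGen (K.Edge i) (r 0) (r k) := by
    intro r k
    induction k with
    | zero => exact fun _ => Relation.EqvGen.refl _
    | succ k ih =>
      exact fun hr => (ih fun m hm => hr m (by omega)).trans _ _ _ (.rel _ _ (hr k (by omega)))
  have hv0 : Relation.EqvGen (K.Edge i) v (q 0) := by
    have := hpath q _ hq
    rw [hqv] at this
    exact this.symm
  have hmem : ∀ u, Relation.EqvGen (K.Edge i) v u ↔ ∃ m ≤ h i (q 0), u = p m := by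
    intro u
    constructor
    · exact fun hu => (heqv _ _ (hv0.symm.trans _ _ _ hu)).1 ⟨0, by omega, hp0.symm⟩
    · rintro ⟨m, hm, rfl⟩
      have := hpath p m fun l hl => hp l (by omega)
      rw [hp0] at this
      exact hv0.trans _ _ _ this
  refine ⟨h i (q 0), fun m => p m, ?_, ?_, ?_⟩
  · intro a b hab
    have h1 := htail a (by omega)
    have h2 := htail b (by omega)
    simp only at hab
    rw [hab] at h1
    exact Fin.ext (by omega)
  · intro u
    rw [hmem]
    constructor
    · rintro ⟨m, hm, rfl⟩
      exact ⟨⟨m, by omega⟩, rfl⟩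
    · rintro ⟨m, rfl⟩
      exact ⟨m, by omega, rfl⟩
  · intro u w hu
    constructor
    · intro huw
      obtain ⟨m, hm, rfl⟩ := (hmem u).1 hu
      obtain ⟨l, hl, rfl⟩ := (hclosed _ _ huw).1 ⟨m, hm, rfl⟩
      have h1 := H.tail_edge huw
      rw [htail m hm, htail l hl] at h1
      subst h1
      exact ⟨⟨m, by omega⟩, rfl, rfl⟩
    · rintro ⟨m, rfl, rfl⟩
      simpa using hp m m.2

/-- If along the `i`-lines each edge either decreases `t_j` or increases `h_j`, and the edges of
the first kind precede those of the second kind, then the label of an edge records its kind. -/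
theorem label_eq_zero_iff (H : IsHeight K h t) {i j : Fin n}
    (hdich : ∀ u v, K.Edge i u v →
      (t j u = t j v + 1 ∧ h j v = h j u) ∨ (t j v = t j u ∧ h j v = h j u + 1))
    (hconv : ∀ u v w, K.Edge i u v → K.Edge i v w → 2 * h j v ≤ h j u + h j w)
    {u v : V} (huv : K.Edge i u v) : K.label i j u v = 0 ↔ h j v = h j u := by
  -- The increments of `h j` along an `i`-line are 0 or 1 and, by convexity, nondecreasing; a zero
  -- increment is preceded by zero increments only.
  have hback : ∀ u v w, K.Edge i u v → K.Edge i v w → h j w = h j v → h j v = h j u := by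
    intro u v w e1 e2 e3
    have := hconv u v w e1 e2
    have := hdich u v e1
    omega
  -- Induction on the distance to the end of the line: the critical vertex is where the increments
  -- switch from 0 to 1, or the end if they never do.
  have hcrit : ∀ (m : ℕ) (u v : V), h i v = m → K.Edge i u v → h j v = h j u →
      ∃ r, K.IsCritical i j r ∧ Relation.ReflTransGen (K.Edge i) v r := by
    intro m
    induction m with
    | zero =>
      intro u v hm e1 e2
      refine ⟨v, ⟨?_, ?_⟩, .refl⟩
      · intro a b hab hbv
        have key : h j b = h j a := by
          induction hbv using Relation.ReflTransGen.head_induction_on generalizing a with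
          | refl => rwa [H.unique_in hab e1]
          | head e _ ih => exact hback _ _ _ hab e (ih _ e)
        have := hdich a b hab
        simp only [H.tailLen_eq, H.headLen_eq]
        omega
      · intro a b hva hab
        have : h i v = 0 := hm
        rcases hva.cases_head with rfl | ⟨w, e, _⟩
        · have := H.head_edge hab
          omega
        · have := H.head_edge e
          omega
    | succ m ih =>
      intro u v hm e1 e2
      obtain ⟨w, hw⟩ := H.head_pos (i := i) (u := v) (by omega)
      by_cases hd : h j w = h j v
      · obtain ⟨r, hr, hwr⟩ := ih v w (by have := H.head_edge hw; omega) hw hd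
        exact ⟨r, hr, .head hw hwr⟩
      refine ⟨v, ⟨?_, ?_⟩, .refl⟩
      · intro a b hab hbv
        have key : h j b = h j a := by
          induction hbv using Relation.ReflTransGen.head_induction_on generalizing a with
          | refl => rwa [H.unique_in hab e1]
          | head e _ ih => exact hback _ _ _ hab e (ih _ e)
        have := hdich a b hab
        simp only [H.tailLen_eq, H.headLen_eq]
        omega
      · intro a b hva hab
        have key : h j b ≠ h j a := by
          induction hva generalizing b with
          | refl => rwa [H.unique_out hab hw]
          | tail _ e ih => exact fun hne => ih _ e (hback _ _ _ e hab hne)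
        have := hdich a b hab
        simp only [H.tailLen_eq, H.headLen_eq]
        omega
  unfold label
  split_ifs with hc
  · obtain ⟨-, r, hr, hvr⟩ := hc
    have := (hr.1 u v huv hvr).2
    simp only [H.headLen_eq] at this
    simp [this]
  · simp only [false_iff]
    exact fun hd => hc ⟨huv, hcrit _ u v rfl huv hd⟩

end IsHeight

end ColoredDigraph

namespace CrossingModel

variable {n : ℕ}

/-! ### First and last maximizers -/

/-- `a` is the first maximizer of `P`. -/
def IsFirstMax (P : ℕ → ℤ) (a : ℕ) : Prop := (∀ q < a, P q < P a) ∧ ∀ q, P q ≤ P a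

/-- `a` is the last maximizer of `P`. -/
def IsLastMax (P : ℕ → ℤ) (a : ℕ) : Prop := (∀ q, a < q → P q < P a) ∧ ∀ q, P q ≤ P a

theorem IsFirstMax.unique {P : ℕ → ℤ} {a b : ℕ} (ha : IsFirstMax P a) (hb : IsFirstMax P b) :
    a = b := by
  by_contra h
  rcases lt_or_gt_of_ne h with h | h
  · exact absurd (hb.1 a h) (not_lt.2 (ha.2 b))
  · exact absurd (ha.1 b h) (not_lt.2 (hb.2 a))

theorem IsLastMax.unique {P : ℕ → ℤ} {a b : ℕ} (ha : IsLastMax P a) (hb : IsLastMax P b) :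
    a = b := by
  by_contra h
  rcases lt_or_gt_of_ne h with h | h
  · exact absurd (ha.1 b h) (not_lt.2 (hb.2 a))
  · exact absurd (hb.1 a h) (not_lt.2 (ha.2 b))

theorem exists_isMax {P : ℕ → ℤ} {N : ℕ} (hP : ∀ q, N ≤ q → P q = P N) : ∃ a, ∀ q, P q ≤ P a := by
  obtain ⟨a, -, ha⟩ := Finset.exists_max_image (Finset.range (N + 1)) P ⟨0, by simp⟩
  refine ⟨a, fun q => ?_⟩
  rcases le_total q N with h | h
  · exact ha q (by simp; omega)
  · exact hP q h ▸ ha N (by simp)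

theorem exists_isFirstMax {P : ℕ → ℤ} {N : ℕ} (hP : ∀ q, N ≤ q → P q = P N) :
    ∃ a, IsFirstMax P a := by
  classical
  have h := exists_isMax hP
  refine ⟨Nat.find h, fun q hq => ?_, Nat.find_spec h⟩
  have := Nat.find_min h hq
  by_contra hlt
  exact this fun r => (Nat.find_spec h r).trans (not_lt.1 hlt)

/-- The hypothesis `P N < P a` keeps the maximum out of the constant tail, where there would be no
last maximizer. -/
theorem exists_isLastMax {P : ℕ → ℤ} {N : ℕ} (hP : ∀ q, N ≤ q → P q = P N) {a : ℕ}
    (ha : P N < P a) : ∃ b, IsLastMax P b := by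
  classical
  obtain ⟨m, hm⟩ := exists_isMax hP
  have hmN : m ≤ N := by
    by_contra hlt
    have := hP m (by omega)
    have := hm a
    omega
  have hspec : P (Nat.findGreatest (fun q => P q = P m) N) = P m :=
    Nat.findGreatest_spec (P := fun q => P q = P m) hmN rfl
  refine ⟨_, fun q hq => ?_, fun q => hspec ▸ hm q⟩
  rw [hspec]
  refine lt_of_le_of_ne (hm q) fun heq => ?_
  rcases le_total q N with h | h
  · exact Nat.findGreatest_is_greatest hq h heq
  · have := hP q h
    have := hm a
    omega

/-! ### Gelfand–Tsetlin patterns -/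

/-- The sums over the multinodes outside the supporting graph. -/
def boundarySum (c : Fin n → ℕ) (i j : ℕ) : ℤ :=
  ∑ k : Fin n, if j = 0 ∨ j + k < i then (c k : ℤ) else 0

/-- Gelfand–Tsetlin patterns, with the boundary values determined by `c`. -/
structure IsPattern (c : Fin n → ℕ) (x : ℕ → ℕ → ℤ) : Prop where
  boundary : ∀ i j, j = 0 ∨ i < j ∨ n < i → x i j = boundarySum c i j
  up : ∀ i j, x i j ≤ x (i + 1) j
  down : ∀ i j, x (i + 1) (j + 1) ≤ x i j

/-- The cumulative difference of the upper and lower slacks at level `i + 1`. -/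
def pot (x : ℕ → ℕ → ℤ) (i q : ℕ) : ℤ :=
  ∑ r ∈ Finset.range q, (x i r - x (i + 1) (r + 1) - x (i + 1) r + x (i + 2) (r + 1))

/-- The array obtained from `x` by adding `e` to the entry at `(i, j)`. -/
def bump (x : ℕ → ℕ → ℤ) (i j : ℕ) (e : ℤ) : ℕ → ℕ → ℤ :=
  fun a b => if a = i ∧ b = j then x a b + e else x a b

theorem bump_apply (x : ℕ → ℕ → ℤ) (i j : ℕ) (e : ℤ) (a b : ℕ) :
    bump x i j e a b = x a b + if a = i ∧ b = j then e else 0 := by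
  rw [bump]
  split_ifs <;> ring

theorem bump_comm (x : ℕ → ℕ → ℤ) (i j i' j' : ℕ) (e e' : ℤ) :
    bump (bump x i j e) i' j' e' = bump (bump x i' j' e') i j e := by
  funext a b
  simp only [bump]
  split_ifs <;> ring

theorem bump_neg (x : ℕ → ℕ → ℤ) (i j : ℕ) (e : ℤ) : bump (bump x i j e) i j (-e) = x := by
  funext a b
  simp only [bump]
  split_ifs <;> ring

theorem pot_zero (x : ℕ → ℕ → ℤ) (i : ℕ) : pot x i 0 = 0 := rfl

theorem pot_succ (x : ℕ → ℕ → ℤ) (i q : ℕ) : pot x i (q + 1) =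
    pot x i q + (x i q - x (i + 1) (q + 1) - x (i + 1) q + x (i + 2) (q + 1)) :=
  Finset.sum_range_succ _ _

/-- The entry `(i + 1, j)` occurs with a minus sign in the summands `r = j - 1` and `r = j`; for `j
= 0` the former would be missing. In the potentials of the adjacent levels it occurs once, with a
plus sign. -/
theorem pot_bump_self (x : ℕ → ℕ → ℤ) (i : ℕ) {j : ℕ} (hj : 1 ≤ j) (e : ℤ) (q : ℕ) :
    pot (bump x (i + 1) j e) i q =
      pot x i q - (if j ≤ q then e else 0) - (if j < q then e else 0) := by
  induction q with
  | zero => simp [pot_zero]; omega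
  | succ q ih =>
    rw [pot_succ, pot_succ, ih]
    simp only [bump, true_and]
    split_ifs <;> omega

theorem pot_bump_below (x : ℕ → ℕ → ℤ) (i j : ℕ) (e : ℤ) (q : ℕ) :
    pot (bump x (i + 1) j e) (i + 1) q = pot x (i + 1) q + (if j < q then e else 0) := by
  induction q with
  | zero => simp [pot_zero]
  | succ q ih =>
    rw [pot_succ, pot_succ, ih]
    simp only [bump, true_and]
    split_ifs <;> omega

theorem pot_bump_above (x : ℕ → ℕ → ℤ) (i : ℕ) {j : ℕ} (hj : 1 ≤ j) (e : ℤ) (q : ℕ) :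
    pot (bump x (i + 1 + 1) j e) i q = pot x i q + (if j ≤ q then e else 0) := by
  induction q with
  | zero => simp [pot_zero]; omega
  | succ q ih =>
    rw [pot_succ, pot_succ, ih]
    simp only [bump, true_and]
    split_ifs <;> omega

theorem pot_bump_of_ne (x : ℕ → ℕ → ℤ) {i i' : ℕ} (h0 : i' ≠ i) (h1 : i' ≠ i + 1)
    (h2 : i' ≠ i + 2) (j : ℕ) (e : ℤ) (q : ℕ) : pot (bump x i' j e) i q = pot x i q := by
  refine Finset.sum_congr rfl fun r _ => ?_
  simp only [bump]
  split_ifs <;> omega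

namespace IsPattern

variable {c : Fin n → ℕ} {x : ℕ → ℕ → ℤ}

theorem eq_zero (hx : IsPattern c x) {i j : ℕ} (h : i < j) : x i j = 0 := by
  rw [hx.boundary i j (.inr (.inl h)), boundarySum]
  exact Finset.sum_eq_zero fun k _ => if_neg (by omega)

theorem left_eq (hx : IsPattern c x) (i i' : ℕ) : x i 0 = x i' 0 := by
  rw [hx.boundary i 0 (.inl rfl), hx.boundary i' 0 (.inl rfl)]
  simp [boundarySum]

theorem pot_eq (hx : IsPattern c x) (i q : ℕ) (hq : i + 2 ≤ q) : pot x i q = pot x i (i + 2) := by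
  induction q, hq using Nat.le_induction with
  | base => rfl
  | succ q hq ih =>
    rw [pot_succ, ih, hx.eq_zero (i := i) (j := q) (by omega),
      hx.eq_zero (i := i + 1) (j := q) (by omega),
      hx.eq_zero (i := i + 1) (j := q + 1) (by omega),
      hx.eq_zero (i := i + 2) (j := q + 1) (by omega)]
    ring

/-- The increment from `i + 1` to `i + 2` is `x (i + 2) (i + 2) - x (i + 1) (i + 1) ≤ 0`, and the
potential is constant afterwards. -/
theorem pot_le_of_firstMax (hx : IsPattern c x) {i j : ℕ} (h : IsFirstMax (pot x i) j) :
    j ≤ i + 1 := by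
  by_contra hlt
  have h1 := h.1 (i + 1) (by omega)
  have h2 := hx.pot_eq i j (by omega)
  have h3 := pot_succ x i (i + 1)
  have h4 := hx.eq_zero (i := i) (j := i + 1) (by omega)
  have h5 := hx.eq_zero (i := i + 1) (j := i + 1 + 1) (by omega)
  have h6 := hx.down (i + 1) (i + 1)
  have h7 : i + 1 + 1 = i + 2 := rfl
  simp only [h7] at *
  omega

theorem le_of_lastMax (hx : IsPattern c x) {i j : ℕ} (h : IsLastMax (pot x i) j) :
    j ≤ i + 1 := by
  by_contra hlt
  have h1 := h.1 (j + 1) (by omega)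
  rw [hx.pot_eq i j (by omega), hx.pot_eq i (j + 1) (by omega)] at h1
  exact lt_irrefl _ h1

/-- Column 0 is constant, so the first increment is `x (i + 2) 1 - x (i + 1) 1 ≥ 0`. -/
theorem pos_of_lastMax (hx : IsPattern c x) {i j : ℕ} (h : IsLastMax (pot x i) j) : 1 ≤ j := by
  by_contra hlt
  obtain rfl : j = 0 := by omega
  have h1 := h.1 1 (by omega)
  have h2 := pot_succ x i 0
  have h3 := hx.left_eq i (i + 1)
  have h4 := hx.up (i + 1) 1
  simp only [pot_zero, zero_add] at *
  have h7 : i + 1 + 1 = i + 2 := rfl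
  simp only [h7] at *
  omega

/-- The increment into a first maximizer is strictly positive. Combined with either of two pattern
inequalities, this makes both upper bounds on the raised entry strict. For last maximizers the
negative next increment does the same for the lower bounds. -/
theorem bump_firstMax (hx : IsPattern c x) {i j : ℕ} (hi : i < n) (hj : 1 ≤ j)
    (h : IsFirstMax (pot x i) j) : IsPattern c (bump x (i + 1) j 1) := by
  have hji := hx.pot_le_of_firstMax h
  obtain ⟨j, rfl⟩ : ∃ l, j = l + 1 := ⟨j - 1, by omega⟩
  have h1 := h.1 j (by omega)
  rw [pot_succ] at h1
  have hup := hx.up i j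
  have hdown := hx.down (i + 1) j
  have h7 : i + 1 + 1 = i + 2 := rfl
  rw [h7] at hdown
  refine ⟨fun a b hab => ?_, fun a b => ?_, fun a b => ?_⟩
  · rw [← hx.boundary a b hab, bump, if_neg (by omega)]
  · have := hx.up a b
    simp only [bump]
    split_ifs with ha hb hb <;> try omega
    obtain ⟨rfl, rfl⟩ := ha
    rw [h7]
    omega
  · have := hx.down a b
    simp only [bump]
    split_ifs with ha hb hb <;> try omega
    obtain ⟨ha, hb⟩ := ha
    obtain rfl : a = i := by omega
    obtain rfl : b = j := by omega
    omega

theorem bump_lastMax (hx : IsPattern c x) {i j : ℕ} (hi : i < n)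
    (h : IsLastMax (pot x i) j) : IsPattern c (bump x (i + 1) j (-1)) := by
  have hji := hx.le_of_lastMax h
  have hj := hx.pos_of_lastMax h
  have h1 := h.1 (j + 1) (by omega)
  rw [pot_succ] at h1
  have hup := hx.up (i + 1) (j + 1)
  have hdown := hx.down i j
  have hup' := hx.up i j
  have hdown' := hx.down (i + 1) j
  have h7 : i + 1 + 1 = i + 2 := rfl
  rw [h7] at hup hdown'
  refine ⟨fun a b hab => ?_, fun a b => ?_, fun a b => ?_⟩
  · rw [← hx.boundary a b hab, bump, if_neg (by omega)]
  · have := hx.up a b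
    simp only [bump]
    split_ifs with ha hb hb <;> try omega
    obtain ⟨hb, rfl⟩ := hb
    obtain rfl : a = i := by omega
    omega
  · have := hx.down a b
    simp only [bump]
    split_ifs with ha hb hb <;> try omega
    obtain ⟨rfl, rfl⟩ := hb
    rw [h7]
    omega

end IsPattern

/-! ### Moves of patterns -/

/-- The move of color `i` on patterns. -/
def Step (i : ℕ) (x y : ℕ → ℕ → ℤ) : Prop :=
  ∃ j, 1 ≤ j ∧ IsFirstMax (pot x i) j ∧ y = bump x (i + 1) j 1

theorem Step.unique {i : ℕ} {x y y' : ℕ → ℕ → ℤ} (h : Step i x y) (h' : Step i x y') :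
    y = y' := by
  obtain ⟨j, -, hj, rfl⟩ := h
  obtain ⟨j', -, hj', rfl⟩ := h'
  rw [hj.unique hj']

/-- The potential falls by 0 before `j`, by 1 at `j` and by 2 after it: strict inequalities before
`j` become weak, weak ones after it become strict. This is what makes moves reversible. -/
theorem isLastMax_bump {x : ℕ → ℕ → ℤ} {i j : ℕ} (hj : 1 ≤ j) (h : IsFirstMax (pot x i) j) :
    IsLastMax (pot (bump x (i + 1) j 1) i) j := by
  simp only [IsLastMax, pot_bump_self x i hj]
  refine ⟨fun q hq => ?_, fun q => ?_⟩
  · have := h.2 q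
    split_ifs <;> omega
  · have := h.1 q
    have := h.2 q
    split_ifs <;> omega

theorem isFirstMax_bump {x : ℕ → ℕ → ℤ} {i j : ℕ} (hj : 1 ≤ j) (h : IsLastMax (pot x i) j) :
    IsFirstMax (pot (bump x (i + 1) j (-1)) i) j := by
  simp only [IsFirstMax, pot_bump_self x i hj]
  refine ⟨fun q hq => ?_, fun q => ?_⟩
  · have := h.2 q
    split_ifs <;> omega
  · have := h.1 q
    have := h.2 q
    split_ifs <;> omega

theorem step_iff {i : ℕ} {x y : ℕ → ℕ → ℤ} :
    Step i x y ↔ ∃ j, 1 ≤ j ∧ IsLastMax (pot y i) j ∧ x = bump y (i + 1) j (-1) := by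
  constructor
  · rintro ⟨j, hj, h, rfl⟩
    exact ⟨j, hj, isLastMax_bump hj h, (bump_neg _ _ _ _).symm⟩
  · rintro ⟨j, hj, h, rfl⟩
    refine ⟨j, hj, isFirstMax_bump hj h, ?_⟩
    simpa using (bump_neg y (i + 1) j (-1)).symm

theorem Step.unique_in {i : ℕ} {x x' y : ℕ → ℕ → ℤ} (h : Step i x y) (h' : Step i x' y) :
    x = x' := by
  obtain ⟨j, -, hj, rfl⟩ := step_iff.1 h
  obtain ⟨j', -, hj', rfl⟩ := step_iff.1 h'
  rw [hj.unique hj']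

/-- The maximum of `pot x i`. -/
def peak (x : ℕ → ℕ → ℤ) (i : ℕ) : ℤ :=
  (Finset.range (i + 3)).sup' ⟨0, by simp⟩ (pot x i)

theorem IsPattern.peak_eq {c : Fin n → ℕ} {x : ℕ → ℕ → ℤ} (hx : IsPattern c x) {i a : ℕ}
    (ha : ∀ q, pot x i q ≤ pot x i a) : peak x i = pot x i a := by
  refine le_antisymm (Finset.sup'_le _ _ fun q _ => ha q) ?_
  rcases le_total a (i + 2) with h | h
  · exact Finset.le_sup' (pot x i) (by simp; omega)
  · rw [hx.pot_eq i a h]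
    exact Finset.le_sup' (pot x i) (by simp)

theorem IsPattern.exists_firstMax {c : Fin n → ℕ} {x : ℕ → ℕ → ℤ} (hx : IsPattern c x) (i : ℕ) :
    ∃ a, IsFirstMax (pot x i) a ∧ peak x i = pot x i a := by
  obtain ⟨a, ha⟩ := exists_isFirstMax (hx.pot_eq i)
  exact ⟨a, ha, hx.peak_eq ha.2⟩

/-- The distance to the end of the line of color `i`. -/
def headHeight (i : ℕ) (x : ℕ → ℕ → ℤ) : ℕ := (peak x i).toNat

/-- The distance from the beginning of the line of color `i`. -/
def tailHeight (i : ℕ) (x : ℕ → ℕ → ℤ) : ℕ := (peak x i - pot x i (i + 2)).toNat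

section

variable {c : Fin n → ℕ} {x : ℕ → ℕ → ℤ}

theorem headHeight_eq (hx : IsPattern c x) {i a : ℕ} (ha : ∀ q, pot x i q ≤ pot x i a) :
    (headHeight i x : ℤ) = pot x i a := by
  have := ha 0
  rw [pot_zero] at this
  rw [headHeight, hx.peak_eq ha, Int.toNat_of_nonneg this]

theorem tailHeight_eq (hx : IsPattern c x) {i a : ℕ} (ha : ∀ q, pot x i q ≤ pot x i a) :
    (tailHeight i x : ℤ) = pot x i a - pot x i (i + 2) := by
  have := ha (i + 2)
  rw [tailHeight, hx.peak_eq ha, Int.toNat_of_nonneg (by omega)]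

theorem headHeight_pos (hx : IsPattern c x) {i : ℕ} (h : 0 < headHeight i x) :
    ∃ y, Step i x y := by
  obtain ⟨a, ha, -⟩ := hx.exists_firstMax i
  have := headHeight_eq hx ha.2
  refine ⟨_, a, Nat.one_le_iff_ne_zero.2 ?_, ha, rfl⟩
  rintro rfl
  rw [pot_zero] at this
  omega

theorem tailHeight_pos (hx : IsPattern c x) {i : ℕ} (h : 0 < tailHeight i x) :
    ∃ a, IsLastMax (pot x i) a := by
  obtain ⟨a, ha, -⟩ := hx.exists_firstMax i
  have := tailHeight_eq hx ha.2
  exact exists_isLastMax (hx.pot_eq i) (a := a) (by omega)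

theorem Step.isPattern (hx : IsPattern c x) {i : ℕ} (hi : i < n) {y : ℕ → ℕ → ℤ}
    (h : Step i x y) : IsPattern c y := by
  obtain ⟨j, hj, h, rfl⟩ := h
  exact hx.bump_firstMax hi hj h

theorem Step.isPattern_in (hx : IsPattern c x) {i : ℕ} (hi : i < n) {y : ℕ → ℕ → ℤ}
    (h : Step i y x) : IsPattern c y := by
  obtain ⟨j, hj, hlast, rfl⟩ := step_iff.1 h
  exact hx.bump_lastMax hi hlast

/-- The maximum falls by 1 and the final value by 2. -/
theorem Step.heights (hx : IsPattern c x) {i : ℕ} (hi : i < n) {y : ℕ → ℕ → ℤ}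
    (h : Step i x y) :
    headHeight i x = headHeight i y + 1 ∧ tailHeight i y = tailHeight i x + 1 := by
  have hy := h.isPattern hx hi
  obtain ⟨j, hj, h, rfl⟩ := h
  have hji := hx.pot_le_of_firstMax h
  have h1 := headHeight_eq hx h.2
  have h2 := headHeight_eq hy (isLastMax_bump hj h).2
  have h3 := tailHeight_eq hx h.2
  have h4 := tailHeight_eq hy (isLastMax_bump hj h).2
  simp only [pot_bump_self x i hj, le_refl, lt_irrefl, if_true, if_false,
    if_pos (show j ≤ i + 2 by omega), if_pos (show j < i + 2 by omega)] at h2 h4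
  omega

end

end CrossingModel

/-! ### Interaction of moves on neighboring levels. -/

namespace CrossingModel

variable {n : ℕ} {c : Fin n → ℕ} {x : ℕ → ℕ → ℤ} {i a b : ℕ}

/-- `a` is a maximizer of `P`. -/
def IsMax (P : ℕ → ℤ) (a : ℕ) : Prop := ∀ q, P q ≤ P a

/-- The move adds 1 to the next potential beyond `a`, in particular to its final value. The maximum
grows if some maximizer lies beyond `a`; otherwise the values there are strictly smaller and can at
most catch up. -/
theorem heights_below (hx : IsPattern c x) (hi : i < n) (ha : 1 ≤ a)
    (h : IsFirstMax (pot x i) a) :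
    (headHeight (i + 1) (bump x (i + 1) a 1) = headHeight (i + 1) x + 1 ∧
      tailHeight (i + 1) (bump x (i + 1) a 1) = tailHeight (i + 1) x ∧
      ∃ q, a < q ∧ IsMax (pot x (i + 1)) q) ∨
    (headHeight (i + 1) (bump x (i + 1) a 1) = headHeight (i + 1) x ∧
      tailHeight (i + 1) x = tailHeight (i + 1) (bump x (i + 1) a 1) + 1 ∧
      ∀ q, IsMax (pot x (i + 1)) q → q ≤ a) := by
  have hai := hx.pot_le_of_firstMax h
  have hy := hx.bump_firstMax hi ha h
  have hpot := pot_bump_below x i a 1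
  have hend := hpot (i + 1 + 2)
  rw [if_pos (by omega)] at hend
  by_cases hq : ∃ q, a < q ∧ IsMax (pot x (i + 1)) q
  · obtain ⟨q, haq, hq⟩ := hq
    have hq' : IsMax (pot (bump x (i + 1) a 1) (i + 1)) q := by
      intro r
      have := hq r
      rw [hpot, hpot, if_pos haq]
      split_ifs <;> omega
    have h1 := headHeight_eq hx hq
    have h2 := tailHeight_eq hx hq
    have h3 := headHeight_eq hy hq'
    have h4 := tailHeight_eq hy hq'
    have h5 := hpot q
    rw [if_pos haq] at h5
    exact .inl ⟨by omega, by omega, q, haq, hq⟩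
  · push Not at hq
    obtain ⟨q, hqf, -⟩ := hx.exists_firstMax (i + 1)
    have hqa : q ≤ a := not_lt.1 fun hlt => hq q hlt hqf.2
    have hq' : IsMax (pot (bump x (i + 1) a 1) (i + 1)) q := by
      intro r
      have h1 := hqf.2 r
      rw [hpot, hpot, if_neg hqa.not_gt]
      split_ifs with har
      · have : pot x (i + 1) r ≠ pot x (i + 1) q := fun heq =>
          hq r har fun s => heq ▸ hqf.2 s
        omega
      · omega
    have h1 := headHeight_eq hx hqf.2
    have h2 := tailHeight_eq hx hqf.2
    have h3 := headHeight_eq hy hq'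
    have h4 := tailHeight_eq hy hq'
    have h5 := hpot q
    rw [if_neg (by omega)] at h5
    exact .inr ⟨by omega, by omega, fun r hr => not_lt.1 fun hlt => hq r hlt hr⟩

theorem heights_above (hx : IsPattern c x) (hi : i + 1 < n) (hb : 1 ≤ b)
    (h : IsFirstMax (pot x (i + 1)) b) :
    (headHeight i (bump x (i + 1 + 1) b 1) = headHeight i x + 1 ∧
      tailHeight i (bump x (i + 1 + 1) b 1) = tailHeight i x ∧
      ∃ q, b ≤ q ∧ IsMax (pot x i) q) ∨
    (headHeight i (bump x (i + 1 + 1) b 1) = headHeight i x ∧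
      tailHeight i x = tailHeight i (bump x (i + 1 + 1) b 1) + 1 ∧
      ∀ q, IsMax (pot x i) q → q < b) := by
  have hbi := hx.pot_le_of_firstMax h
  have hy := hx.bump_firstMax hi hb h
  have hpot := pot_bump_above x i hb 1
  have hend := hpot (i + 2)
  rw [if_pos (by omega)] at hend
  by_cases hq : ∃ q, b ≤ q ∧ IsMax (pot x i) q
  · obtain ⟨q, hbq, hq⟩ := hq
    have hq' : IsMax (pot (bump x (i + 1 + 1) b 1) i) q := by
      intro r
      have := hq r
      rw [hpot, hpot, if_pos hbq]
      split_ifs <;> omega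
    have h1 := headHeight_eq hx hq
    have h2 := tailHeight_eq hx hq
    have h3 := headHeight_eq hy hq'
    have h4 := tailHeight_eq hy hq'
    have h5 := hpot q
    rw [if_pos hbq] at h5
    exact .inl ⟨by omega, by omega, q, hbq, hq⟩
  · push Not at hq
    obtain ⟨q, hqf, -⟩ := hx.exists_firstMax i
    have hqa : q < b := not_le.1 fun hlt => hq q hlt hqf.2
    have hq' : IsMax (pot (bump x (i + 1 + 1) b 1) i) q := by
      intro r
      have h1 := hqf.2 r
      rw [hpot, hpot, if_neg hqa.not_ge]
      split_ifs with har
      · have : pot x i r ≠ pot x i q := fun heq => hq r har fun s => heq ▸ hqf.2 s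
        omega
      · omega
    have h1 := headHeight_eq hx hqf.2
    have h2 := tailHeight_eq hx hqf.2
    have h3 := headHeight_eq hy hq'
    have h4 := tailHeight_eq hy hq'
    have h5 := hpot q
    rw [if_neg (by omega)] at h5
    exact .inr ⟨by omega, by omega, fun r hr => not_le.1 fun hlt => hq r hlt hr⟩

theorem peak_congr {y : ℕ → ℕ → ℤ} (h : ∀ q, pot y i q = pot x i q) : peak y i = peak x i := by
  rw [peak, peak, funext h]

/-- Consecutive moves of one color drift weakly to the left. Hence a maximizer of a neighboring
potential that makes the first move raise its maximum does so for the second move too, which gives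
convexity. -/
theorem firstMax_le_of_step (ha : 1 ≤ a) (h : IsFirstMax (pot x i) a)
    (hb : IsFirstMax (pot (bump x (i + 1) a 1) i) b) : b ≤ a :=
  not_lt.1 fun hlt => absurd (hb.1 a hlt) (not_lt.2 ((isLastMax_bump ha h).2 b))

theorem convex_below (hx : IsPattern c x) (hi : i < n) {y z : ℕ → ℕ → ℤ} (h1 : Step i x y)
    (h2 : Step i y z) :
    2 * headHeight (i + 1) y ≤ headHeight (i + 1) x + headHeight (i + 1) z := by
  have hy := h1.isPattern hx hi
  obtain ⟨a, ha, h1, rfl⟩ := h1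
  obtain ⟨a', ha', h2, rfl⟩ := h2
  have hle := firstMax_le_of_step ha h1 h2
  have k1 := heights_below hx hi ha h1
  have k2 := heights_below hy hi ha' h2
  rcases k1 with ⟨k1, -, q, haq, hq⟩ | ⟨k1, -⟩
  · rcases k2 with ⟨k2, -⟩ | ⟨k2, -, k3⟩
    · omega
    · have : q ≤ a' := k3 q fun r => by
        have := hq r
        rw [pot_bump_below, pot_bump_below, if_pos haq]
        split_ifs <;> omega
      omega
  · omega

theorem convex_above (hx : IsPattern c x) (hi : i + 1 < n) {y z : ℕ → ℕ → ℤ}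
    (h1 : Step (i + 1) x y) (h2 : Step (i + 1) y z) :
    2 * headHeight i y ≤ headHeight i x + headHeight i z := by
  have hy := h1.isPattern hx hi
  obtain ⟨a, ha, h1, rfl⟩ := h1
  obtain ⟨a', ha', h2, rfl⟩ := h2
  have hle := firstMax_le_of_step ha h1 h2
  have k1 := heights_above hx hi ha h1
  have k2 := heights_above hy hi ha' h2
  rcases k1 with ⟨k1, -, q, haq, hq⟩ | ⟨k1, -⟩
  · rcases k2 with ⟨k2, -⟩ | ⟨k2, -, k3⟩
    · omega
    · have : q < a' := k3 q fun r => by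
        have := hq r
        rw [pot_bump_above x i ha, pot_bump_above x i ha, if_pos haq]
        split_ifs <;> omega
      omega
  · omega

/-- Lifting the strictly smaller values beyond `a` creates no maximizer before `b`; and since `b ≤
a`, lifting `pot x i` from `b` onwards lifts `a` along with everything to its right. -/
theorem commute_of_not_below (hb : 1 ≤ b)
    (hP : IsFirstMax (pot x i) a) (hQ : IsFirstMax (pot x (i + 1)) b)
    (h : ∀ q, IsMax (pot x (i + 1)) q → q ≤ a) :
    b ≤ a ∧ IsFirstMax (pot (bump x (i + 1) a 1) (i + 1)) b ∧
      IsFirstMax (pot (bump x (i + 1 + 1) b 1) i) a := by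
  have hba := h b hQ.2
  have h' : ∀ q, a < q → pot x (i + 1) q < pot x (i + 1) b := fun q hq =>
    lt_of_le_of_ne (hQ.2 q) fun heq => absurd (h q fun r => heq ▸ hQ.2 r) (not_le.2 hq)
  refine ⟨hba, ?_, ?_⟩
  · simp only [IsFirstMax, pot_bump_below]
    refine ⟨fun q hq => ?_, fun q => ?_⟩
    · have h₁ := hQ.1 q; grind
    · have h₁ := hQ.2 q; grind
  · simp only [IsFirstMax, pot_bump_above x i hb]
    refine ⟨fun q hq => ?_, fun q => ?_⟩
    · have h₁ := hP.1 q; grind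
    · have h₁ := hP.2 q; grind

theorem commute_of_not_above (hb : 1 ≤ b)
    (hP : IsFirstMax (pot x i) a) (hQ : IsFirstMax (pot x (i + 1)) b)
    (h : ∀ q, IsMax (pot x i) q → q < b) :
    a < b ∧ IsFirstMax (pot (bump x (i + 1) a 1) (i + 1)) b ∧
      IsFirstMax (pot (bump x (i + 1 + 1) b 1) i) a := by
  have hba := h a hP.2
  have h' : ∀ q, b ≤ q → pot x i q < pot x i a := fun q hq =>
    lt_of_le_of_ne (hP.2 q) fun heq => absurd (h q fun r => heq ▸ hP.2 r) (not_lt.2 hq)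
  refine ⟨hba, ?_, ?_⟩
  · simp only [IsFirstMax, pot_bump_below]
    refine ⟨fun q hq => ?_, fun q => ?_⟩
    · have h₁ := hQ.1 q; grind
    · have h₁ := hQ.2 q; grind
  · simp only [IsFirstMax, pot_bump_above x i hb]
    refine ⟨fun q hq => ?_, fun q => ?_⟩
    · have h₁ := hP.1 q; grind
    · have h₁ := hP.2 q; grind

theorem commute_of_below (hb : 1 ≤ b)
    (hP : IsLastMax (pot x i) a) (hQ : IsLastMax (pot x (i + 1)) b)
    (h : ∃ q, a < q ∧ IsMax (pot (bump x (i + 1) a (-1)) (i + 1)) q) :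
    (∀ q, IsMax (pot (bump x (i + 1 + 1) b (-1)) i) q → q < b) ∧
      IsLastMax (pot (bump x (i + 1) a (-1)) (i + 1)) b ∧
      IsLastMax (pot (bump x (i + 1 + 1) b (-1)) i) a := by
  obtain ⟨q₀, hq₀, hmax⟩ := h
  simp only [IsLastMax, IsMax, pot_bump_below, pot_bump_above x i hb] at hmax ⊢
  have hmax' := hmax b
  have hb₀ := hQ.2 q₀
  have hb₁ := hQ.1 q₀
  -- If `b ≤ a`, the lowering would spare `b` but not `q₀`, and `q₀` could not be a maximizer.
  have hab : a < b := by grind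
  refine ⟨fun q hq => ?_, ⟨fun q hq => ?_, fun q => ?_⟩, ⟨fun q hq => ?_, fun q => ?_⟩⟩
  · have := hP.2 q
    have := hq a
    grind
  · have := hQ.1 q hq
    grind
  · have := hQ.2 q
    have := hmax q
    grind
  · have := hP.1 q hq
    grind
  · have := hP.2 q
    grind

theorem commute_of_above (hb : 1 ≤ b)
    (hP : IsLastMax (pot x i) a) (hQ : IsLastMax (pot x (i + 1)) b)
    (h : ∃ q, b ≤ q ∧ IsMax (pot (bump x (i + 1 + 1) b (-1)) i) q) :
    (∀ q, IsMax (pot (bump x (i + 1) a (-1)) (i + 1)) q → q ≤ a) ∧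
      IsLastMax (pot (bump x (i + 1) a (-1)) (i + 1)) b ∧
      IsLastMax (pot (bump x (i + 1 + 1) b (-1)) i) a := by
  obtain ⟨q₀, hq₀, hmax⟩ := h
  simp only [IsLastMax, IsMax, pot_bump_below, pot_bump_above x i hb] at hmax ⊢
  have hmax' := hmax a
  have hb₀ := hP.2 q₀
  have hb₁ := hP.1 q₀
  have hab : b ≤ a := by grind
  refine ⟨fun q hq => ?_, ⟨fun q hq => ?_, fun q => ?_⟩, ⟨fun q hq => ?_, fun q => ?_⟩⟩
  · have := hQ.2 q
    have := hq b
    grind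
  · have := hQ.1 q hq
    grind
  · have := hQ.2 q
    grind
  · have := hP.1 q hq
    grind
  · have := hP.2 q
    have := hmax q
    grind

/-- Both words raise the same four entries in different orders. For `b ≤ a` the columns are `a, b₁,
b, a₂` along one word and `b, a, a₂, b₁` along the other; for `a < b` they are `a, b, b₂, a₁` and
`b, a₁, a, b₂`. -/
theorem verma_forward (ha : 1 ≤ a) (hb : 1 ≤ b)
    (hP : IsFirstMax (pot x i) a) (hQ : IsFirstMax (pot x (i + 1)) b)
    (h1 : ∃ q, a < q ∧ IsMax (pot x (i + 1)) q) (h2 : ∃ q, b ≤ q ∧ IsMax (pot x i) q) :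
    ∃ z, (∃ x₁ x₂ x₃, Step i x x₁ ∧ Step (i + 1) x₁ x₂ ∧ Step (i + 1) x₂ x₃ ∧ Step i x₃ z) ∧
      (∃ y₁ y₂ y₃, Step (i + 1) x y₁ ∧ Step i y₁ y₂ ∧ Step i y₂ y₃ ∧ Step (i + 1) y₃ z) := by
  classical
  rcases le_or_gt b a with hba | hab
  -- `b₁` becomes the first maximizer once the values beyond `a` are lifted. Later the values of
  -- `pot x i` on `[b, a)` are lifted by 1 while the net change at `a` is 0, so the next first
  -- maximizer is the first column from `b` on with value one below the maximum, or `a` itself.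
  · have hex : ∃ q, b ≤ q ∧ (pot x i q = pot x i a - 1 ∨ q = a) := ⟨a, hba, .inr rfl⟩
    obtain ⟨b₁, ⟨hab₁, hb₁⟩, hb₁'⟩ :
        ∃ q, (a < q ∧ IsMax (pot x (i + 1)) q) ∧ ∀ r < q, ¬ (a < r ∧ IsMax (pot x (i + 1)) r) :=
      ⟨_, Nat.find_spec h1, fun r hr => Nat.find_min h1 hr⟩
    obtain ⟨a₂, ⟨hba₂, ha₂⟩, ha₂'⟩ :
        ∃ q, (b ≤ q ∧ (pot x i q = pot x i a - 1 ∨ q = a)) ∧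
          ∀ r < q, ¬ (b ≤ r ∧ (pot x i r = pot x i a - 1 ∨ r = a)) :=
      ⟨_, Nat.find_spec hex, fun r hr => Nat.find_min hex hr⟩
    have ha₂a : a₂ ≤ a := not_lt.1 fun hlt => ha₂' a hlt ⟨hba, .inr rfl⟩
    have hb₁b : pot x (i + 1) b₁ = pot x (i + 1) b := le_antisymm (hQ.2 _) (hb₁ b)
    have hb₁lt : ∀ q, a < q → q < b₁ → pot x (i + 1) q < pot x (i + 1) b := fun q h h' =>
      lt_of_le_of_ne (hQ.2 q) fun heq => hb₁' q h' ⟨h, fun r => heq ▸ hQ.2 r⟩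
    refine ⟨_, ⟨_, _, _, ⟨a, ha, hP, rfl⟩, ⟨b₁, by omega, ?_, rfl⟩, ⟨b, hb, ?_, rfl⟩,
      ⟨a₂, by omega, ?_, rfl⟩⟩, ⟨_, _, _, ⟨b, hb, hQ, rfl⟩, ⟨a, ha, ?_, rfl⟩,
      ⟨a₂, by omega, ?_, rfl⟩, ⟨b₁, by omega, ?_, ?_⟩⟩⟩
    · simp only [IsFirstMax, pot_bump_below]
      exact ⟨fun q hq => by have h₁ := hQ.2 q; have h₂ := hb₁lt q; grind, fun q => by have h₁ := hQ.2 q; grind⟩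
    · simp only [IsFirstMax, pot_bump_below, pot_bump_self _ (i + 1) (show 1 ≤ b₁ by omega)]
      exact ⟨fun q hq => by have h₁ := hQ.1 q; grind, fun q => by have h₁ := hQ.2 q; have h₂ := hb₁lt q; grind⟩
    · simp only [IsFirstMax, pot_bump_above _ i (show 1 ≤ b₁ by omega), pot_bump_above _ i hb,
        pot_bump_self _ i ha]
      exact ⟨fun q hq => by have h₁ := hP.1 q; have h₂ := hP.2 q; have h₃ := ha₂' q; grind, fun q => by have h₁ := hP.1 q; have h₂ := hP.2 q; grind⟩
    · simp only [IsFirstMax, pot_bump_above _ i hb]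
      exact ⟨fun q hq => by have h₁ := hP.1 q; grind, fun q => by have h₁ := hP.2 q; grind⟩
    · simp only [IsFirstMax, pot_bump_above _ i hb, pot_bump_self _ i ha]
      exact ⟨fun q hq => by have h₁ := hP.1 q; have h₂ := hP.2 q; have h₃ := ha₂' q; grind, fun q => by have h₁ := hP.1 q; have h₂ := hP.2 q; grind⟩
    · simp only [IsFirstMax, pot_bump_below, pot_bump_self _ (i + 1) hb]
      exact ⟨fun q hq => by have h₁ := hQ.1 q; have h₂ := hQ.2 q; have h₃ := hb₁lt q; grind, fun q => by have h₁ := hQ.1 q; have h₂ := hQ.2 q; grind⟩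
    · funext p q
      simp only [bump_apply]
      ring
  · have hex : ∃ q, a < q ∧ (pot x (i + 1) q = pot x (i + 1) b - 1 ∨ q = b) := ⟨b, hab, .inr rfl⟩
    obtain ⟨a₁, ⟨hba₁, ha₁⟩, ha₁'⟩ :
        ∃ q, (b ≤ q ∧ IsMax (pot x i) q) ∧ ∀ r < q, ¬ (b ≤ r ∧ IsMax (pot x i) r) :=
      ⟨_, Nat.find_spec h2, fun r hr => Nat.find_min h2 hr⟩
    obtain ⟨b₂, ⟨hab₂, hb₂⟩, hb₂'⟩ :
        ∃ q, (a < q ∧ (pot x (i + 1) q = pot x (i + 1) b - 1 ∨ q = b)) ∧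
          ∀ r < q, ¬ (a < r ∧ (pot x (i + 1) r = pot x (i + 1) b - 1 ∨ r = b)) :=
      ⟨_, Nat.find_spec hex, fun r hr => Nat.find_min hex hr⟩
    have hb₂b : b₂ ≤ b := not_lt.1 fun hlt => hb₂' b hlt ⟨hab, .inr rfl⟩
    have ha₁a : pot x i a₁ = pot x i a := le_antisymm (hP.2 _) (ha₁ a)
    have ha₁lt : ∀ q, b ≤ q → q < a₁ → pot x i q < pot x i a := fun q h h' =>
      lt_of_le_of_ne (hP.2 q) fun heq => ha₁' q h' ⟨h, fun r => heq ▸ hP.2 r⟩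
    refine ⟨_, ⟨_, _, _, ⟨a, ha, hP, rfl⟩, ⟨b, hb, ?_, rfl⟩, ⟨b₂, by omega, ?_, rfl⟩,
      ⟨a₁, by omega, ?_, rfl⟩⟩, ⟨_, _, _, ⟨b, hb, hQ, rfl⟩, ⟨a₁, by omega, ?_, rfl⟩,
      ⟨a, ha, ?_, rfl⟩, ⟨b₂, by omega, ?_, ?_⟩⟩⟩
    · simp only [IsFirstMax, pot_bump_below]
      exact ⟨fun q hq => by have h₁ := hQ.1 q; grind, fun q => by have h₁ := hQ.2 q; grind⟩
    · simp only [IsFirstMax, pot_bump_below, pot_bump_self _ (i + 1) hb]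
      exact ⟨fun q hq => by have h₁ := hQ.1 q; have h₂ := hQ.2 q; have h₃ := hb₂' q; grind, fun q => by have h₁ := hQ.1 q; have h₂ := hQ.2 q; grind⟩
    · simp only [IsFirstMax, pot_bump_above _ i (show 1 ≤ b₂ by omega), pot_bump_above _ i hb,
        pot_bump_self _ i ha]
      exact ⟨fun q hq => by have h₁ := hP.1 q; have h₂ := hP.2 q; have h₃ := ha₁lt q; grind, fun q => by have h₁ := hP.1 q; have h₂ := hP.2 q; grind⟩
    · simp only [IsFirstMax, pot_bump_above _ i hb]
      exact ⟨fun q hq => by have h₁ := hP.2 q; have h₂ := ha₁lt q; grind, fun q => by have h₁ := hP.2 q; grind⟩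
    · simp only [IsFirstMax, pot_bump_above _ i hb, pot_bump_self _ i (show 1 ≤ a₁ by omega)]
      exact ⟨fun q hq => by have h₁ := hP.1 q; have h₂ := hP.2 q; grind, fun q => by have h₁ := hP.1 q; have h₂ := hP.2 q; have h₃ := ha₁lt q; grind⟩
    · simp only [IsFirstMax, pot_bump_below, pot_bump_self _ (i + 1) hb]
      exact ⟨fun q hq => by have h₁ := hQ.1 q; have h₂ := hQ.2 q; have h₃ := hb₂' q; grind, fun q => by have h₁ := hQ.1 q; have h₂ := hQ.2 q; grind⟩
    · funext p q
      simp only [bump_apply]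
      ring

theorem exists_last {p : ℕ → Prop} {N : ℕ} (h : ∃ q ≤ N, p q) :
    ∃ q ≤ N, p q ∧ ∀ r ≤ N, q < r → ¬ p r := by
  classical
  obtain ⟨q, hq, hp⟩ := h
  exact ⟨Nat.findGreatest p N, Nat.findGreatest_le N, Nat.findGreatest_spec hq hp,
    fun r hr hlt => Nat.findGreatest_is_greatest hlt hr⟩

theorem back_step (hx : IsPattern c x) (hi : i < n) (h : IsLastMax (pot x i) a) :
    Step i (bump x (i + 1) a (-1)) x ∧ IsPattern c (bump x (i + 1) a (-1)) :=
  ⟨step_iff.2 ⟨a, hx.pos_of_lastMax h, h, rfl⟩, hx.bump_lastMax hi h⟩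

/-- This carries the label condition from the predecessor to `x`: beyond `a` the predecessor's
values are strictly below its maximum, so adding 1 there leaves `q` a maximizer. -/
theorem isMax_of_below (hP : ∃ q, IsMax (pot (bump x (i + 1) a (-1)) (i + 1)) q)
    (h : ∀ q, IsMax (pot (bump x (i + 1) a (-1)) (i + 1)) q → q ≤ a) :
    ∃ q ≤ a, IsMax (pot x (i + 1)) q := by
  obtain ⟨q, hq⟩ := hP
  refine ⟨q, h q hq, fun r => ?_⟩
  have h₁ := h r
  have h₂ := h q hq
  have h₃ := hq r
  have h₄ : pot (bump x (i + 1) a (-1)) (i + 1) r = pot (bump x (i + 1) a (-1)) (i + 1) q → r ≤ a :=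
    fun heq => h₁ fun s => heq ▸ hq s
  simp only [pot_bump_below] at h₃ h₄
  grind

theorem isMax_of_above (hb : 1 ≤ b) (hP : ∃ q, IsMax (pot (bump x (i + 1 + 1) b (-1)) i) q)
    (h : ∀ q, IsMax (pot (bump x (i + 1 + 1) b (-1)) i) q → q < b) :
    ∃ q < b, IsMax (pot x i) q := by
  obtain ⟨q, hq⟩ := hP
  refine ⟨q, h q hq, fun r => ?_⟩
  have h₁ := h r
  have h₂ := h q hq
  have h₃ := hq r
  have h₄ : pot (bump x (i + 1 + 1) b (-1)) i r = pot (bump x (i + 1 + 1) b (-1)) i q → r < b :=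
    fun heq => h₁ fun s => heq ▸ hq s
  simp only [pot_bump_above x i hb] at h₃ h₄
  grind

/-- The mirror image of `verma_forward`, with last maximizers and searches from the right; the bound
`b - 1` encodes `q < b`. -/
theorem verma_backward (hx : IsPattern c x) (hi : i + 1 < n)
    (hP : IsLastMax (pot x i) a) (hQ : IsLastMax (pot x (i + 1)) b)
    (h1 : ∃ q ≤ a, IsMax (pot x (i + 1)) q) (h2 : ∃ q < b, IsMax (pot x i) q) :
    ∃ z, (∃ x₁ x₂ x₃, Step i x₁ x ∧ Step (i + 1) x₂ x₁ ∧ Step (i + 1) x₃ x₂ ∧ Step i z x₃) ∧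
      (∃ y₁ y₂ y₃, Step (i + 1) y₁ x ∧ Step i y₂ y₁ ∧ Step i y₃ y₂ ∧ Step (i + 1) z y₃) := by
  have hi' : i < n := by omega
  have ha := hx.pos_of_lastMax hP
  have hb := hx.pos_of_lastMax hQ
  obtain ⟨sx₁, px₁⟩ := back_step hx hi' hP
  obtain ⟨sy₁, py₁⟩ := back_step hx hi hQ
  rcases lt_or_ge a b with hab | hba
  · obtain ⟨b₁, hb₁a, hb₁, hb₁'⟩ := exists_last h1
    obtain ⟨a₂, ha₂b, ⟨haa₂, ha₂⟩, ha₂'⟩ := exists_last (N := b - 1)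
      (p := fun q => a ≤ q ∧ (pot x i q = pot x i a - 1 ∨ q = a)) ⟨a, by omega, le_rfl, .inr rfl⟩
    have hb₁b : pot x (i + 1) b₁ = pot x (i + 1) b := le_antisymm (hQ.2 _) (hb₁ b)
    have hb₁lt : ∀ q, q ≤ a → b₁ < q → pot x (i + 1) q < pot x (i + 1) b := fun q h h' =>
      lt_of_le_of_ne (hQ.2 q) fun heq => hb₁' q h h' fun r => heq ▸ hQ.2 r
    have lx₁ : IsLastMax (pot (bump x (i + 1) a (-1)) (i + 1)) b₁ := by
      simp only [IsLastMax, pot_bump_below]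
      exact ⟨fun q hq => by have h₁ := hQ.2 q; have h₂ := hb₁lt q; grind, fun q => by have h₁ := hQ.2 q; grind⟩
    -- The search to the left might have ended in column 0; the pattern inequalities exclude this,
    -- which is why every intermediate array is kept as a pattern.
    have hb₁1 := px₁.pos_of_lastMax lx₁
    obtain ⟨sx₂, px₂⟩ := back_step px₁ hi lx₁
    have lx₂ : IsLastMax (pot (bump (bump x (i + 1) a (-1)) (i + 1 + 1) b₁ (-1)) (i + 1)) b := by
      simp only [IsLastMax, pot_bump_below, pot_bump_self _ (i + 1) hb₁1]
      exact ⟨fun q hq => by have h₁ := hQ.1 q; grind, fun q => by have h₁ := hQ.2 q; have h₂ := hb₁lt q; grind⟩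
    obtain ⟨sx₃, px₃⟩ := back_step px₂ hi lx₂
    have lx₃ : IsLastMax (pot (bump (bump (bump x (i + 1) a (-1)) (i + 1 + 1) b₁ (-1))
        (i + 1 + 1) b (-1)) i) a₂ := by
      simp only [IsLastMax, pot_bump_above _ i hb₁1, pot_bump_above _ i hb, pot_bump_self _ i ha]
      exact ⟨fun q hq => by have h₁ := hP.1 q; have h₂ := hP.2 q; have h₃ := ha₂' q; grind, fun q => by have h₁ := hP.1 q; have h₂ := hP.2 q; grind⟩
    obtain ⟨sx₄, -⟩ := back_step px₃ hi' lx₃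
    have ly₁ : IsLastMax (pot (bump x (i + 1 + 1) b (-1)) i) a := by
      simp only [IsLastMax, pot_bump_above _ i hb]
      exact ⟨fun q hq => by have h₁ := hP.1 q; grind, fun q => by have h₁ := hP.2 q; grind⟩
    obtain ⟨sy₂, py₂⟩ := back_step py₁ hi' ly₁
    have ly₂ : IsLastMax (pot (bump (bump x (i + 1 + 1) b (-1)) (i + 1) a (-1)) i) a₂ := by
      simp only [IsLastMax, pot_bump_above _ i hb, pot_bump_self _ i ha]
      exact ⟨fun q hq => by have h₁ := hP.1 q; have h₂ := hP.2 q; have h₃ := ha₂' q; grind, fun q => by have h₁ := hP.1 q; have h₂ := hP.2 q; grind⟩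
    obtain ⟨sy₃, py₃⟩ := back_step py₂ hi' ly₂
    have ly₃ : IsLastMax (pot (bump (bump (bump x (i + 1 + 1) b (-1)) (i + 1) a (-1))
        (i + 1) a₂ (-1)) (i + 1)) b₁ := by
      simp only [IsLastMax, pot_bump_below, pot_bump_self _ (i + 1) hb]
      exact ⟨fun q hq => by have h₁ := hQ.1 q; have h₂ := hQ.2 q; have h₃ := hb₁lt q; grind, fun q => by have h₁ := hQ.1 q; have h₂ := hQ.2 q; grind⟩
    obtain ⟨sy₄, -⟩ := back_step py₃ hi ly₃
    refine ⟨_, ⟨_, _, _, sx₁, sx₂, sx₃, sx₄⟩, ⟨_, _, _, sy₁, sy₂, sy₃, ?_⟩⟩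
    convert sy₄ using 1
    funext p q
    simp only [bump_apply]
    ring
  · obtain ⟨a₁, ha₁b, ha₁, ha₁'⟩ := exists_last (N := b - 1) (p := IsMax (pot x i))
      (h2.imp fun q hq => ⟨by omega, hq.2⟩)
    obtain ⟨b₂, hb₂a, ⟨hbb₂, hb₂⟩, hb₂'⟩ := exists_last (N := a)
      (p := fun q => b ≤ q ∧ (pot x (i + 1) q = pot x (i + 1) b - 1 ∨ q = b))
      ⟨b, hba, le_rfl, .inr rfl⟩
    have ha₁a : pot x i a₁ = pot x i a := le_antisymm (hP.2 _) (ha₁ a)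
    have ha₁lt : ∀ q, q < b → a₁ < q → pot x i q < pot x i a := fun q h h' =>
      lt_of_le_of_ne (hP.2 q) fun heq => ha₁' q (by omega) h' fun r => heq ▸ hP.2 r
    have lx₁ : IsLastMax (pot (bump x (i + 1) a (-1)) (i + 1)) b := by
      simp only [IsLastMax, pot_bump_below]
      exact ⟨fun q hq => by have h₁ := hQ.1 q; grind, fun q => by have h₁ := hQ.2 q; grind⟩
    obtain ⟨sx₂, px₂⟩ := back_step px₁ hi lx₁
    have lx₂ : IsLastMax (pot (bump (bump x (i + 1) a (-1)) (i + 1 + 1) b (-1)) (i + 1)) b₂ := by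
      simp only [IsLastMax, pot_bump_below, pot_bump_self _ (i + 1) hb]
      exact ⟨fun q hq => by have h₁ := hQ.1 q; have h₂ := hQ.2 q; have h₃ := hb₂' q; grind, fun q => by have h₁ := hQ.1 q; have h₂ := hQ.2 q; grind⟩
    obtain ⟨sx₃, px₃⟩ := back_step px₂ hi lx₂
    have lx₃ : IsLastMax (pot (bump (bump (bump x (i + 1) a (-1)) (i + 1 + 1) b (-1))
        (i + 1 + 1) b₂ (-1)) i) a₁ := by
      simp only [IsLastMax, pot_bump_above _ i (hb.trans hbb₂), pot_bump_above _ i hb,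
        pot_bump_self _ i ha]
      exact ⟨fun q hq => by have h₁ := hP.1 q; have h₂ := hP.2 q; have h₃ := ha₁lt q; grind, fun q => by have h₁ := hP.1 q; have h₂ := hP.2 q; grind⟩
    obtain ⟨sx₄, -⟩ := back_step px₃ hi' lx₃
    have ly₁ : IsLastMax (pot (bump x (i + 1 + 1) b (-1)) i) a₁ := by
      simp only [IsLastMax, pot_bump_above _ i hb]
      exact ⟨fun q hq => by have h₁ := hP.2 q; have h₂ := ha₁lt q; grind, fun q => by have h₁ := hP.2 q; grind⟩
    have ha₁1 := py₁.pos_of_lastMax ly₁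
    obtain ⟨sy₂, py₂⟩ := back_step py₁ hi' ly₁
    have ly₂ : IsLastMax (pot (bump (bump x (i + 1 + 1) b (-1)) (i + 1) a₁ (-1)) i) a := by
      simp only [IsLastMax, pot_bump_above _ i hb, pot_bump_self _ i ha₁1]
      exact ⟨fun q hq => by have h₁ := hP.1 q; have h₂ := hP.2 q; grind, fun q => by have h₁ := hP.1 q; have h₂ := hP.2 q; have h₃ := ha₁lt q; grind⟩
    obtain ⟨sy₃, py₃⟩ := back_step py₂ hi' ly₂
    have ly₃ : IsLastMax (pot (bump (bump (bump x (i + 1 + 1) b (-1)) (i + 1) a₁ (-1))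
        (i + 1) a (-1)) (i + 1)) b₂ := by
      simp only [IsLastMax, pot_bump_below, pot_bump_self _ (i + 1) hb]
      exact ⟨fun q hq => by have h₁ := hQ.1 q; have h₂ := hQ.2 q; have h₃ := hb₂' q; grind, fun q => by have h₁ := hQ.1 q; have h₂ := hQ.2 q; grind⟩
    obtain ⟨sy₄, -⟩ := back_step py₃ hi ly₃
    refine ⟨_, ⟨_, _, _, sx₁, sx₂, sx₃, sx₄⟩, ⟨_, _, _, sy₁, sy₂, sy₃, ?_⟩⟩
    convert sy₄ using 1
    funext p q
    simp only [bump_apply]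
    ring

end CrossingModel

/-! ### Feasible functions on the extended graph. -/

namespace CrossingModel

variable {n : ℕ} {c : Fin n → ℕ}

/-- The counterpart of `IsFeasible` for functions on the extended graph. -/
structure IsExtFeasible (c : Fin n → ℕ) (g : Fin n → ℕ → ℕ → ℤ) : Prop where
  off : ∀ (k : Fin n) (i j : ℕ), ¬ (1 ≤ j ∧ j ≤ i ∧ i ≤ j + k ∧ j + k ≤ n) →
    g k i j = if j = 0 ∨ j + k < i then (c k : ℤ) else 0
  up : ∀ k i j, g k i j ≤ g k (i + 1) j
  down : ∀ k i j, g k (i + 1) (j + 1) ≤ g k i j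
  switch : ∀ i j, 1 ≤ j → j ≤ i → i ≤ n → ∃ k, ExtSwitchCondition g i j k

theorem extend_of_mem (c : Fin n → ℕ) (f : Node n → ℤ) {k : Fin n} {i j : ℕ}
    (h : 1 ≤ j ∧ j ≤ i ∧ i ≤ j + k ∧ j + k ≤ n) :
    extend c f k i j = f ⟨k, i, j, h.1, h.2.1, h.2.2.1, h.2.2.2⟩ := dif_pos h

theorem extend_of_notMem (c : Fin n → ℕ) (f : Node n → ℤ) {k : Fin n} {i j : ℕ}
    (h : ¬ (1 ≤ j ∧ j ≤ i ∧ i ≤ j + k ∧ j + k ≤ n)) :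
    extend c f k i j = if j = 0 ∨ j + k < i then (c k : ℤ) else 0 := dif_neg h

theorem extend_injective (c : Fin n → ℕ) : Function.Injective (extend c) := by
  intro f f' h
  funext v
  have := congrFun (congrFun (congrFun h v.k) v.i) v.j
  rwa [extend_of_mem c f ⟨v.one_le_j, v.j_le_i, v.i_le, v.le_n⟩,
    extend_of_mem c f' ⟨v.one_le_j, v.j_le_i, v.i_le, v.le_n⟩] at this

/-- The extra nodes carry the extreme values `c k` and 0, so inequalities across the border of `G`
are the bounds on `f`. In the switch condition, a node outside `G` and its relevant neighbor lie on
the same side and agree. -/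
theorem IsFeasible.isExtFeasible {f : Node n → ℤ} (hf : IsFeasible c f) :
    IsExtFeasible c (extend c f) := by
  refine ⟨fun k i j h => extend_of_notMem c f h, fun k i j => ?_, fun k i j => ?_,
    fun i j hj hji hin => ?_⟩
  · by_cases h1 : 1 ≤ j ∧ j ≤ i ∧ i ≤ j + k ∧ j + k ≤ n <;>
      by_cases h2 : 1 ≤ j ∧ j ≤ i + 1 ∧ i + 1 ≤ j + k ∧ j + k ≤ n
    · rw [extend_of_mem c f h1, extend_of_mem c f h2]
      exact hf.monotone _ _ (.inl ⟨rfl, rfl, rfl⟩)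
    · rw [extend_of_mem c f h1, extend_of_notMem c f h2, if_pos (by omega)]
      exact (hf.bounds _).2
    · rw [extend_of_notMem c f h1, extend_of_mem c f h2, if_neg (by omega)]
      exact (hf.bounds _).1
    · rw [extend_of_notMem c f h1, extend_of_notMem c f h2]
      split_ifs <;> omega
  · by_cases h1 : 1 ≤ j ∧ j ≤ i ∧ i ≤ j + k ∧ j + k ≤ n <;>
      by_cases h2 : 1 ≤ j + 1 ∧ j + 1 ≤ i + 1 ∧ i + 1 ≤ j + 1 + k ∧ j + 1 + k ≤ n
    · rw [extend_of_mem c f h1, extend_of_mem c f h2]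
      exact hf.monotone _ _ (.inr ⟨rfl, rfl, rfl⟩)
    · rw [extend_of_mem c f h1, extend_of_notMem c f h2, if_neg (by omega)]
      exact (hf.bounds _).1
    · rw [extend_of_notMem c f h1, extend_of_mem c f h2, if_pos (by omega)]
      exact (hf.bounds _).2
    · rw [extend_of_notMem c f h1, extend_of_notMem c f h2]
      split_ifs <;> grind
  · obtain ⟨v, rfl, rfl, h1, h2⟩ := hf.switch i j hj hji hin
    have hv₁ := v.i_le
    have hv₂ := v.le_n
    refine ⟨v.k, fun k hk => ?_, fun k hk => ?_⟩
    · have hk' : (k : ℕ) < v.k := hk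
      by_cases hm : 1 ≤ v.j ∧ v.j ≤ v.i ∧ v.i ≤ v.j + k ∧ v.j + k ≤ n
      · obtain ⟨w, ⟨hw1, hw2, hw3⟩, hw⟩ := h1 ⟨k, v.i, v.j, hm.1, hm.2.1, hm.2.2.1, hm.2.2.2⟩
          rfl rfl hk
        have hm' : 1 ≤ v.j + 1 ∧ v.j + 1 ≤ v.i + 1 ∧ v.i + 1 ≤ v.j + 1 + k ∧ v.j + 1 + k ≤ n := by
          omega
        rw [extend_of_mem c f hm, extend_of_mem c f hm', hw]
        exact congrArg f (Node.ext hw1.symm hw2 hw3)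
      · rw [extend_of_notMem c f hm, extend_of_notMem c f (by omega)]
        split_ifs <;> omega
    · have hk' : (v.k : ℕ) < k := hk
      by_cases hm : 1 ≤ v.j ∧ v.j ≤ v.i ∧ v.i ≤ v.j + k ∧ v.j + k ≤ n
      · obtain ⟨w, ⟨hw1, hw2, hw3⟩, hw⟩ := h2 ⟨k, v.i, v.j, hm.1, hm.2.1, hm.2.2.1, hm.2.2.2⟩
          rfl rfl hk
        have hm' : 1 ≤ v.j ∧ v.j ≤ v.i + 1 ∧ v.i + 1 ≤ v.j + k ∧ v.j + k ≤ n := by omega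
        rw [extend_of_mem c f hm, extend_of_mem c f hm', ← hw]
        exact congrArg f (Node.ext hw1.symm hw2.symm hw3.symm)
      · rw [extend_of_notMem c f hm, extend_of_notMem c f (by omega)]
        split_ifs <;> omega

namespace IsExtFeasible

variable {g : Fin n → ℕ → ℕ → ℤ}

/-- Descending edges lead out of `G`, where the values are known to be nonnegative; the upper bound
follows ascending edges backwards. -/
theorem nonneg (hg : IsExtFeasible c g) (k : Fin n) (i j : ℕ) : 0 ≤ g k i j := by
  have h : ∀ m, g k (i + m) (j + m) ≤ g k i j := by
    intro m
    induction m with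
    | zero => exact le_rfl
    | succ m ih => exact (hg.down k (i + m) (j + m)).trans ih
  refine le_trans ?_ (h (n + 1))
  rw [hg.off _ _ _ (by omega)]
  split_ifs <;> omega

theorem le (hg : IsExtFeasible c g) (k : Fin n) (i j : ℕ) : g k i j ≤ c k := by
  have h : ∀ m, g k i j ≤ g k (i + m) j := by
    intro m
    induction m with
    | zero => exact le_rfl
    | succ m ih => exact ih.trans (hg.up k (i + m) j)
  refine (h (j + k + 1)).trans ?_
  rw [hg.off _ _ _ (by omega)]
  split_ifs <;> omega

theorem exists_isFeasible (hg : IsExtFeasible c g) : ∃ f, IsFeasible c f ∧ extend c f = g := by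
  refine ⟨fun v => g v.k v.i v.j, ⟨?_, fun v => ⟨hg.nonneg _ _ _, hg.le _ _ _⟩, ?_⟩, ?_⟩
  · rintro ⟨k, i, j, _, _, _, _⟩ ⟨k', i', j', _, _, _, _⟩ (⟨h1, h2, h3⟩ | ⟨h1, h2, h3⟩) <;>
      dsimp only at h1 h2 h3 <;> subst h1 h2 h3
    · exact hg.up _ _ _
    · exact hg.down _ _ _
  · intro i j hj hji hin
    obtain ⟨k, h1, h2⟩ := hg.switch i j hj hji hin
    -- A switch-node of the extended multinode may lie outside `G`; its index is clamped to `[i - j,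
    -- n - j]`.
    obtain ⟨s, hs1, hs2, hs3, hs4⟩ : ∃ s : Fin n, i ≤ j + s ∧ j + s ≤ n ∧
        (∀ k', k' < s → i ≤ j + (k' : ℕ) → k' < k) ∧
        (∀ k', s < k' → j + (k' : ℕ) ≤ n → k < k') := by
      have hk := k.2
      by_cases ha : j + (k : ℕ) < i
      · refine ⟨⟨i - j, by omega⟩, ?_, ?_, fun k' hk' hi => ?_, fun k' hk' hi => ?_⟩ <;>
          simp only [Fin.lt_def] at * <;> omega
      · by_cases hb : n < j + k
        · refine ⟨⟨n - j, by omega⟩, ?_, ?_, fun k' hk' hi => ?_, fun k' hk' hi => ?_⟩ <;>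
            simp only [Fin.lt_def] at * <;> omega
        · exact ⟨k, by omega, by omega, fun k' h _ => h, fun k' h _ => h⟩
    refine ⟨⟨s, i, j, hj, hji, hs1, hs2⟩, rfl, rfl, ?_, ?_⟩
    · rintro ⟨k', i', j', p1, p2, p3, p4⟩ e1 e2 hlt
      dsimp only at e1 e2 hlt
      subst e1 e2
      have hlt' : (k' : ℕ) < s := hlt
      exact ⟨⟨k', i' + 1, j' + 1, by omega, by omega, by omega, by omega⟩, ⟨rfl, rfl, rfl⟩,
        h1 k' (hs3 k' hlt p3)⟩
    · rintro ⟨k', i', j', p1, p2, p3, p4⟩ e1 e2 hlt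
      dsimp only at e1 e2 hlt
      subst e1 e2
      have hlt' : (s : ℕ) < k' := hlt
      exact ⟨⟨k', i' + 1, j', by omega, by omega, by omega, by omega⟩, ⟨rfl, rfl, rfl⟩,
        h2 k' (hs4 k' hlt p4)⟩
  · funext k i j
    by_cases h : 1 ≤ j ∧ j ≤ i ∧ i ≤ j + k ∧ j + k ≤ n
    · rw [extend_of_mem _ _ h]
    · rw [extend_of_notMem _ _ h, hg.off _ _ _ h]

end IsExtFeasible

/-! ### Feasible functions and patterns -/

/-- The sums over the (extended) multinodes. -/
def multinodeSum (g : Fin n → ℕ → ℕ → ℤ) (i j : ℕ) : ℤ := ∑ k, g k i j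

theorem IsExtFeasible.isPattern {g : Fin n → ℕ → ℕ → ℤ} (hg : IsExtFeasible c g) :
    IsPattern c (multinodeSum g) :=
  ⟨fun i j h => Finset.sum_congr rfl fun k _ => hg.off k i j (by omega),
    fun i j => Finset.sum_le_sum fun k _ => hg.up k i j,
    fun i j => Finset.sum_le_sum fun k _ => hg.down k i j⟩

/-- Vectors equal to `z` before some index and to `y` after it form a chain in the pointwise order,
and comparable vectors with equal sums coincide. -/
theorem eq_of_switch {y z w w' : Fin n → ℤ} {s s' : Fin n} (hw : ∀ k, z k ≤ w k ∧ w k ≤ y k)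
    (hw' : ∀ k, z k ≤ w' k ∧ w' k ≤ y k) (hs1 : ∀ k < s, w k = z k) (hs2 : ∀ k, s < k → w k = y k)
    (hs1' : ∀ k < s', w' k = z k) (hs2' : ∀ k, s' < k → w' k = y k)
    (hsum : ∑ k, w k = ∑ k, w' k) : w = w' := by
  have hcomp : (∀ k, w k ≤ w' k) ∨ (∀ k, w' k ≤ w k) := by
    rcases lt_trichotomy s s' with h | rfl | h
    · refine .inr fun k => ?_
      rcases lt_or_ge s k with hk | hk
      · exact hs2 k hk ▸ (hw' k).2
      · exact hs1' k (hk.trans_lt h) ▸ (hw k).1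
    · rcases le_total (w s) (w' s) with hle | hle
      · refine .inl fun k => ?_
        rcases lt_trichotomy s k with hk | rfl | hk
        · rw [hs2 k hk, hs2' k hk]
        · exact hle
        · rw [hs1 k hk, hs1' k hk]
      · refine .inr fun k => ?_
        rcases lt_trichotomy s k with hk | rfl | hk
        · rw [hs2 k hk, hs2' k hk]
        · exact hle
        · rw [hs1 k hk, hs1' k hk]
    · refine .inl fun k => ?_
      rcases lt_or_ge s' k with hk | hk
      · exact hs2' k hk ▸ (hw k).2
      · exact hs1 k (hk.trans_lt h) ▸ (hw' k).1
  funext k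
  rcases hcomp with h | h
  · exact (Finset.sum_eq_sum_iff_of_le fun k _ => h k).1 hsum k (Finset.mem_univ k)
  · exact ((Finset.sum_eq_sum_iff_of_le fun k _ => h k).1 hsum.symm k (Finset.mem_univ k)).symm

/-- Climb the chain from `z` to `y` in unit steps, always raising the last coordinate still below
`y`. -/
theorem exists_switch (hn : 0 < n) {y z : Fin n → ℤ} (hzy : ∀ k, z k ≤ y k) (m : ℕ)
    (hm : ∑ k, z k + m ≤ ∑ k, y k) :
    ∃ w : Fin n → ℤ, (∀ k, z k ≤ w k ∧ w k ≤ y k) ∧ ∑ k, w k = ∑ k, z k + m ∧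
      ∃ s, (∀ k < s, w k = z k) ∧ ∀ k, s < k → w k = y k := by
  classical
  induction m with
  | zero =>
    refine ⟨z, fun k => ⟨le_rfl, hzy k⟩, by simp, ⟨n - 1, by omega⟩, fun _ _ => rfl, fun k hk => ?_⟩
    have := k.2
    simp only [Fin.lt_def] at hk
    omega
  | succ m ih =>
    obtain ⟨w, hw, hsum, s, hs1, hs2⟩ := ih (by push_cast at hm; omega)
    have hne : (Finset.univ.filter fun k => w k < y k).Nonempty := by
      by_contra h
      rw [Finset.not_nonempty_iff_eq_empty, Finset.filter_eq_empty_iff] at h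
      have := Finset.sum_le_sum fun k hk => not_lt.1 (h (x := k) hk)
      push_cast at hm
      omega
    set r := Finset.max' _ hne with hr
    have hrlt : w r < y r := (Finset.mem_filter.1 (Finset.max'_mem _ hne)).2
    have hgt : ∀ k, r < k → w k = y k := fun k hk =>
      (hw k).2.antisymm (not_lt.1 fun hlt => absurd (Finset.le_max' _ k (by simpa using hlt))
        (not_le.2 hk))
    have hrs : r ≤ s := not_lt.1 fun h => hrlt.ne (hs2 r h)
    refine ⟨Function.update w r (w r + 1), fun k => ?_, ?_, r, fun k hk => ?_, fun k hk => ?_⟩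
    · by_cases hk : k = r
      · have := hw r
        rw [hk]
        simp only [Function.update_self]
        omega
      · simpa [hk] using hw k
    · rw [Finset.sum_update_of_mem (Finset.mem_univ r), ← Finset.erase_eq]
      have := Finset.add_sum_erase Finset.univ w (Finset.mem_univ r)
      push_cast
      omega
    · rw [Function.update_of_ne hk.ne]
      exact hs1 k (hk.trans_le hrs)
    · rw [Function.update_of_ne hk.ne']
      exact hgt k hk

theorem IsExtFeasible.eq_of_multinodeSum_eq {g g' : Fin n → ℕ → ℕ → ℤ} (hg : IsExtFeasible c g)
    (hg' : IsExtFeasible c g') (h : multinodeSum g = multinodeSum g') : g = g' := by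
  have key : ∀ d i, n + 1 ≤ i + d → ∀ k j, g k i j = g' k i j := by
    intro d
    induction d with
    | zero =>
      intro i hi k j
      rw [hg.off _ _ _ (by omega), hg'.off _ _ _ (by omega)]
    | succ d ih =>
      intro i hi k j
      by_cases hm : 1 ≤ j ∧ j ≤ i ∧ i ≤ n
      · have ih' := ih (i + 1) (by omega)
        obtain ⟨s, hs1, hs2⟩ := hg.switch i j hm.1 hm.2.1 hm.2.2
        obtain ⟨s', hs1', hs2'⟩ := hg'.switch i j hm.1 hm.2.1 hm.2.2
        refine congrFun (eq_of_switch (s := s) (s' := s') (y := fun k => g k (i + 1) j)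
          (z := fun k => g k (i + 1) (j + 1)) (w := fun k => g k i j) (w' := fun k => g' k i j)
          (fun k => ⟨hg.down k i j, hg.up k i j⟩)
          (fun k => ⟨?_, ?_⟩) hs1 (fun k hk => (hs2 k hk).symm) (fun k hk => ?_) (fun k hk => ?_)
          (congrFun (congrFun h i) j)) k
        · exact ih' k (j + 1) ▸ hg'.down k i j
        · exact ih' k j ▸ hg'.up k i j
        · exact (hs1' k hk).trans (ih' k (j + 1)).symm
        · exact (hs2' k hk).symm.trans (ih' k j).symm
      · rw [hg.off _ _ _ (by omega), hg'.off _ _ _ (by omega)]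
  funext k i j
  exact key (n + 1) i (by omega) k j

/-- Levels are filled from `n + 1` upwards to 0, `d` counting those below `n + 1` already done. The
pattern inequalities say that each prescribed sum lies between the sums of the two bounding vectors.
-/
theorem IsPattern.exists_isExtFeasible {x : ℕ → ℕ → ℤ} (hx : IsPattern c x) :
    ∃ g, IsExtFeasible c g ∧ multinodeSum g = x := by
  have key : ∀ d ≤ n + 1, ∃ g : Fin n → ℕ → ℕ → ℤ,
      (∀ (k : Fin n) (i j : ℕ), ¬ (1 ≤ j ∧ j ≤ i ∧ i ≤ j + k ∧ j + k ≤ n) →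
        g k i j = if j = 0 ∨ j + k < i then (c k : ℤ) else 0) ∧
      ∀ i, n + 1 ≤ i + d → (∀ k j, 0 ≤ g k i j ∧ g k i j ≤ c k) ∧
        (∀ k j, g k i j ≤ g k (i + 1) j ∧ g k (i + 1) (j + 1) ≤ g k i j) ∧
        (∀ j, ∑ k, g k i j = x i j) ∧
        (∀ j, 1 ≤ j → j ≤ i → i ≤ n → ∃ k, ExtSwitchCondition g i j k) := by
    intro d
    induction d with
    | zero =>
      refine fun _ => ⟨fun k i j => if j = 0 ∨ j + k < i then (c k : ℤ) else 0,
        fun _ _ _ _ => rfl, fun i hi => ⟨fun k j => ?_, fun k j => ?_, fun j => ?_, ?_⟩⟩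
      · dsimp only
        split_ifs <;> omega
      · dsimp only
        constructor <;> split_ifs <;> grind
      · exact (hx.boundary i j (by omega)).symm
      · omega
    | succ d ih =>
      intro hd
      obtain ⟨g, hoff, hg⟩ := ih (by omega)
      obtain ⟨i₀, hi₀⟩ : ∃ i₀, i₀ + d = n := ⟨n - d, by omega⟩
      obtain ⟨hbd, hmono, hsum, -⟩ := hg (i₀ + 1) (by omega)
      have hw : ∀ j, ∃ w : Fin n → ℤ, 1 ≤ j → j ≤ i₀ →
          (∀ k, g k (i₀ + 1) (j + 1) ≤ w k ∧ w k ≤ g k (i₀ + 1) j) ∧ ∑ k, w k = x i₀ j ∧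
          ∃ s, (∀ k < s, w k = g k (i₀ + 1) (j + 1)) ∧ ∀ k, s < k → w k = g k (i₀ + 1) j := by
        intro j
        by_cases hj : 1 ≤ j ∧ j ≤ i₀
        · have h1 := hx.down i₀ j
          have h2 := hx.up i₀ j
          rw [← hsum] at h1 h2
          obtain ⟨w, hw1, hw2, hw3⟩ := exists_switch (by omega)
            (fun k => ((hmono k (j + 1)).1.trans (hmono k j).2 :
              g k (i₀ + 1) (j + 1) ≤ g k (i₀ + 1) j))
            (x i₀ j - ∑ k, g k (i₀ + 1) (j + 1)).toNat (by omega)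
          exact ⟨w, fun _ _ => ⟨hw1, by omega, hw3⟩⟩
        · exact ⟨0, fun h1 h2 => absurd ⟨h1, h2⟩ hj⟩
      choose w hw using hw
      refine ⟨fun k i j => if i = i₀ ∧ 1 ≤ j ∧ j ≤ i₀ then w j k else g k i j, ?_, ?_⟩
      · intro k i j hm
        dsimp only
        split_ifs with hi hc hc
        -- Outside `G` the upper and lower bounds from the next level coincide, so the new values
        -- are the boundary values.
        · obtain ⟨rfl, hj1, hj2⟩ := hi
          have h1 := ((hw j hj1 hj2).1 k).1
          have h2 := ((hw j hj1 hj2).1 k).2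
          rw [hoff _ _ _ (by omega), if_pos (by omega)] at h1 h2
          exact h2.antisymm h1
        · obtain ⟨rfl, hj1, hj2⟩ := hi
          have h1 := ((hw j hj1 hj2).1 k).1
          have h2 := ((hw j hj1 hj2).1 k).2
          rw [hoff _ _ _ (by omega), if_neg (by omega)] at h1 h2
          exact h2.antisymm h1
        · rw [hoff k i j hm, if_pos hc]
        · rw [hoff k i j hm, if_neg hc]
      · intro i hi
        rcases Nat.lt_or_ge i₀ i with hlt | hle
        · have hne : i ≠ i₀ := by omega
          have hne' : i + 1 ≠ i₀ := by omega
          simpa only [ExtSwitchCondition, hne, hne', false_and, if_false] using hg i (by omega)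
        · obtain rfl : i = i₀ := by omega
          have hne : i + 1 ≠ i := by omega
          simp only [ExtSwitchCondition, hne, false_and, true_and, if_false]
          refine ⟨fun k j => ?_, fun k j => ?_, fun j => ?_, fun j hj1 hj2 _ => ?_⟩
          · split_ifs with hj
            · have h1 := (hw j hj.1 hj.2).1 k
              have h2 := hbd k j
              have h3 := hbd k (j + 1)
              omega
            · rw [hoff _ _ _ (by omega)]
              split_ifs <;> omega
          · split_ifs with hj
            · exact ((hw j hj.1 hj.2).1 k).symm
            · have h2 := hbd k j
              have h3 := hbd k (j + 1)
              rw [hoff k i j (by omega)]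
              split_ifs with hc
              · rw [hoff k (i + 1) j (by omega), if_pos (by omega)]
                omega
              · rw [hoff k (i + 1) (j + 1) (by omega), if_neg (by omega)]
                omega
          · split_ifs with hj
            · exact (hw j hj.1 hj.2).2.1
            · rw [hx.boundary i j (by omega)]
              exact Finset.sum_congr rfl fun k _ => hoff k i j (by omega)
          · obtain ⟨s, hs1, hs2⟩ := (hw j hj1 hj2).2.2
            simp only [hj1, hj2, and_self, if_true]
            exact ⟨s, hs1, fun k hk => (hs2 k hk).symm⟩
  obtain ⟨g, hoff, hg⟩ := key (n + 1) le_rfl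
  exact ⟨g, ⟨hoff, fun k i j => ((hg i (by omega)).2.1 k j).1,
    fun k i j => ((hg i (by omega)).2.1 k j).2, fun i j => (hg i (by omega)).2.2.2 j⟩,
    funext fun i => funext fun j => (hg i (by omega)).2.2.1 j⟩

/-! ### Moves preserve feasibility -/

theorem pot_multinodeSum_succ {g : Fin n → ℕ → ℕ → ℤ} (i l : ℕ) :
    pot (multinodeSum g) i (l + 1) = pot (multinodeSum g) i l +
      ∑ k, (g k i l - g k (i + 1) (l + 1) - g k (i + 1) l + g k (i + 2) (l + 1)) := by
  rw [pot_succ]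
  simp only [multinodeSum, Finset.sum_add_distrib, Finset.sum_sub_distrib]

/-- The function obtained from `g` by adding one to its value at a node. -/
def raise (g : Fin n → ℕ → ℕ → ℤ) (s : Fin n) (i j : ℕ) : Fin n → ℕ → ℕ → ℤ :=
  fun k a b => if k = s ∧ a = i ∧ b = j then g k a b + 1 else g k a b

theorem multinodeSum_raise (g : Fin n → ℕ → ℕ → ℤ) (s : Fin n) (i j : ℕ) :
    multinodeSum (raise g s i j) = bump (multinodeSum g) i j 1 := by
  funext a b
  rw [bump]
  by_cases h : a = i ∧ b = j
  · obtain ⟨rfl, rfl⟩ := h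
    have hk : ∀ k, raise g s a b k a b = g k a b + if k = s then 1 else 0 := fun k => by
      simp only [raise, and_true]
      split_ifs <;> simp
    simp [multinodeSum, hk, Finset.sum_add_distrib]
  · simp [multinodeSum, raise, h]

/-- Were the SW-edge at `s` tight, the preceding node would satisfy the switch condition too; if
there is none, all SW-edges would be tight, against `hsum`. -/
theorem IsExtFeasible.lt_of_isSwitchNode {g : Fin n → ℕ → ℕ → ℤ} {i j : ℕ} {s : Fin n}
    (hs : IsSwitchNode g i j s) (hsum : ∑ k, g k i j < ∑ k, g k (i + 1) j)
    (hg : IsExtFeasible c g) : g s i j < g s (i + 1) j := by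
  refine lt_of_le_of_ne (hg.up s i j) fun heq => ?_
  rcases Nat.eq_zero_or_pos (s : ℕ) with h0 | hpos
  · refine hsum.ne (Finset.sum_congr rfl fun k _ => ?_)
    rcases eq_or_ne k s with rfl | hk
    · exact heq
    · have : (k : ℕ) ≠ s := fun h => hk (Fin.ext h)
      exact (hs.1.2 k (Fin.lt_def.2 (by omega))).symm
  · have hs2 := s.2
    refine hs.2 ⟨s - 1, by omega⟩ (Fin.lt_def.2 (by simp; omega)) ⟨fun k hk => ?_, fun k hk => ?_⟩
    · simp only [Fin.lt_def] at hk
      exact hs.1.1 k (Fin.lt_def.2 (by omega))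
    · simp only [Fin.lt_def] at hk
      rcases eq_or_ne k s with rfl | hks
      · exact heq.symm
      · have : (k : ℕ) ≠ s := fun h => hks (Fin.ext h)
        exact hs.1.2 k (Fin.lt_def.2 (by omega))

/-- `hws` and `hα` leave room for the increase along the SW- and NW-edges. Besides its own, only the
multinodes `(i, l)` and `(i, l + 1)` have switch conditions involving the raised value: `hα` keeps
the switch-node of `(i, l)` at or before `s`, and `hβ` allows that of `(i, l + 1)` to be moved to
`s`. -/
theorem IsExtFeasible.raise {g : Fin n → ℕ → ℕ → ℤ} (hg : IsExtFeasible c g) {i l : ℕ}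
    {s : Fin n} (hi : i < n) (hli : l ≤ i) (hs : IsSwitchNode g (i + 1) (l + 1) s)
    (h1 : pot (multinodeSum g) i l < pot (multinodeSum g) i (l + 1))
    (h2 : pot (multinodeSum g) i (l + 1 + 1) ≤ pot (multinodeSum g) i (l + 1)) :
    IsExtFeasible c (raise g s (i + 1) (l + 1)) := by
  rw [pot_multinodeSum_succ i l] at h1
  rw [pot_multinodeSum_succ i (l + 1)] at h2
  have hws : g s (i + 1) (l + 1) < g s (i + 2) (l + 1) := by
    refine IsExtFeasible.lt_of_isSwitchNode hs ?_ hg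
    by_contra hle
    have hle := not_lt.1 hle
    have h3 : ∑ k, g k i l ≤ ∑ k, g k (i + 1) l := Finset.sum_le_sum fun k _ => hg.up k i l
    simp only [Finset.sum_add_distrib, Finset.sum_sub_distrib] at h1
    have h4 : i + 1 + 1 = i + 2 := rfl
    rw [h4] at hle
    omega
  have hmem : i + 1 ≤ l + 1 + s ∧ l + 1 + s ≤ n := by
    by_contra hcon
    rw [hg.off s (i + 1) (l + 1) (by omega), hg.off s (i + 2) (l + 1) (by omega)] at hws
    split_ifs at hws <;> grind
  -- If this edge were tight, then for `l ≥ 1` the two switch conditions would make every summand of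
  -- the increment into `l + 1` nonpositive, against `h1`.
  have hα : g s (i + 1) (l + 1) < g s i l := by
    refine lt_of_le_of_ne (hg.down s i l) fun heq => ?_
    rcases Nat.eq_zero_or_pos l with rfl | hl
    · have := hg.le s (i + 2) (0 + 1)
      rw [hg.off s i 0 (by omega), if_pos (.inl rfl)] at heq
      omega
    · obtain ⟨σ, hσ1, hσ2⟩ := hg.switch i l hl hli (by omega)
      have hsσ : s ≤ σ := not_lt.1 fun hlt => by
        have h5 := hσ2 s hlt
        have h6 := hg.down s (i + 1) l
        have h7 : i + 1 + 1 = i + 2 := rfl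
        rw [h7] at h6
        omega
      have : ∑ k, (g k i l - g k (i + 1) (l + 1) - g k (i + 1) l + g k (i + 2) (l + 1)) ≤ 0 := by
        refine Finset.sum_nonpos fun k _ => ?_
        have e1 := hg.up k i l
        have e2 : g k (i + 2) (l + 1) ≤ g k (i + 1) l := hg.down k (i + 1) l
        rcases lt_trichotomy k s with hk | rfl | hk
        · have := hσ1 k (hk.trans_le hsσ)
          omega
        · omega
        · have : g k (i + 2) (l + 1) = g k (i + 1) (l + 1) := hs.1.2 k hk
          omega
      omega
  -- A slack edge at `k₀ < s` would make all summands of the increment after `l + 1` nonnegative and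
  -- the one at `k₀` positive, against `h2`.
  have hβ : l + 1 ≤ i → ∀ k < s, g k i (l + 1) = g k (i + 1) (l + 1 + 1) := by
    intro hl k₀ hk₀
    by_contra hne
    obtain ⟨σ, hσ1, hσ2⟩ := hg.switch i (l + 1) (by omega) hl (by omega)
    have hσ : σ ≤ k₀ := not_lt.1 fun hlt => hne (hσ1 k₀ hlt)
    have hterm : ∀ k, g k (i + 1) (l + 1) - g k i (l + 1) ≤
        g k (i + 2) (l + 1 + 1) - g k (i + 1) (l + 1 + 1) := by
      intro k
      have e1 := hg.down k i (l + 1)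
      have e2 : g k (i + 1) (l + 1 + 1) ≤ g k (i + 2) (l + 1 + 1) := hg.up k (i + 1) (l + 1 + 1)
      rcases lt_or_ge k s with hk | hk
      · have : g k (i + 1) (l + 1) = g k (i + 2) (l + 1 + 1) := hs.1.1 k hk
        omega
      · have := hσ2 k (hσ.trans_lt (hk₀.trans_le hk))
        omega
    have : 0 < ∑ k, (g k i (l + 1) - g k (i + 1) (l + 1 + 1) - g k (i + 1) (l + 1)
        + g k (i + 2) (l + 1 + 1)) := by
      refine Finset.sum_pos' (fun k _ => ?_) ⟨k₀, Finset.mem_univ _, ?_⟩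
      · have := hterm k
        omega
      · have e1 := hg.down k₀ i (l + 1)
        have e2 : g k₀ (i + 1) (l + 1) = g k₀ (i + 2) (l + 1 + 1) := hs.1.1 k₀ hk₀
        omega
    omega
  refine ⟨fun k a b hab => ?_, fun k a b => ?_, fun k a b => ?_, fun a b hb hba han => ?_⟩
  · rw [CrossingModel.raise, if_neg, hg.off k a b hab]
    rintro ⟨rfl, rfl, rfl⟩
    omega
  · have := hg.up k a b
    simp only [CrossingModel.raise]
    split_ifs with ha hb hb
    · omega
    · obtain ⟨rfl, rfl, rfl⟩ := ha
      exact hws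
    · omega
    · exact this
  · have := hg.down k a b
    simp only [CrossingModel.raise]
    split_ifs with ha hb hb
    · omega
    · obtain ⟨rfl, ha, hb⟩ := ha
      obtain rfl : a = i := by omega
      obtain rfl : b = l := by omega
      exact hα
    · omega
    · exact this
  · simp only [ExtSwitchCondition, CrossingModel.raise]
    by_cases e1 : a = i + 1 ∧ b = l + 1
    · obtain ⟨rfl, rfl⟩ := e1
      refine ⟨s, fun k hk => ?_, fun k hk => ?_⟩
      · rw [if_neg (by simp [hk.ne]), if_neg (by omega)]
        exact hs.1.1 k hk
      · rw [if_neg (by omega), if_neg (by simp [hk.ne'])]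
        exact hs.1.2 k hk
    obtain ⟨σ, hσ1, hσ2⟩ := hg.switch a b hb hba han
    by_cases e2 : a = i ∧ b = l
    · obtain ⟨rfl, rfl⟩ := e2
      have hσs : σ ≤ s := not_lt.1 fun hlt => hα.ne' (hσ1 s hlt)
      refine ⟨σ, fun k hk => ?_, fun k hk => ?_⟩
      · rw [if_neg (by omega), if_neg (by simp [(hk.trans_le hσs).ne])]
        exact hσ1 k hk
      · rw [if_neg (by omega), if_neg (by omega)]
        exact hσ2 k hk
    by_cases e3 : a = i ∧ b = l + 1
    · obtain ⟨rfl, rfl⟩ := e3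
      rcases le_total σ s with hσs | hσs
      · refine ⟨s, fun k hk => ?_, fun k hk => ?_⟩
        · rw [if_neg (by omega), if_neg (by omega)]
          exact hβ hba k hk
        · rw [if_neg (by simp [hk.ne']), if_neg (by omega)]
          exact hσ2 k (hσs.trans_lt hk)
      · refine ⟨σ, fun k hk => ?_, fun k hk => ?_⟩
        · rw [if_neg (by omega), if_neg (by omega)]
          exact hσ1 k hk
        · rw [if_neg (by simp [(hσs.trans_lt hk).ne']), if_neg (by omega)]
          exact hσ2 k hk
    refine ⟨σ, fun k hk => ?_, fun k hk => ?_⟩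
    · rw [if_neg (by omega), if_neg (by omega)]
      exact hσ1 k hk
    · rw [if_neg (by omega), if_neg (by omega)]
      exact hσ2 k hk

end CrossingModel

namespace CrossingModel

variable {n : ℕ} {c : Fin n → ℕ}

/-! ### Active multinodes -/

theorem slackDiff_eq (g : Fin n → ℕ → ℕ → ℤ) (i : ℕ) {p q : ℕ} (h : p ≤ q) :
    slackDiff g (i + 1) p q = pot (multinodeSum g) i q - pot (multinodeSum g) i p := by
  induction q, h using Nat.le_induction with
  | base => simp [slackDiff]
  | succ q hq ih =>
    rw [slackDiff] at ih ⊢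
    rw [Finset.sum_Icc_succ_top (by omega), Finset.sum_Ico_succ_top hq, pot_multinodeSum_succ]
    simp only [upperSlack, lowerSlack, Finset.sum_add_distrib, Finset.sum_sub_distrib,
      Nat.add_sub_cancel] at ih ⊢
    have : i + 1 + 1 = i + 2 := rfl
    rw [this] at *
    omega

theorem residualUpper_pos_iff (g : Fin n → ℕ → ℕ → ℤ) (i : ℕ) {j : ℕ} (hj : 1 ≤ j) :
    0 < residualUpper g (i + 1) j ↔
      ∀ p < j, pot (multinodeSum g) i p < pot (multinodeSum g) i j := by
  have : Nonempty (Fin j) := ⟨⟨0, hj⟩⟩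
  rw [residualUpper, lt_max_iff, or_iff_right (lt_irrefl _)]
  constructor
  · intro h p hp
    have h1 := ciInf_le (Set.finite_range fun p : Fin j => slackDiff g (i + 1) p j).bddBelow ⟨p, hp⟩
    rw [slackDiff_eq g i hp.le] at h1
    omega
  · intro h
    obtain ⟨p, hp⟩ := exists_eq_ciInf_of_finite (f := fun p : Fin j => slackDiff g (i + 1) p j)
    rw [← hp, slackDiff_eq g i p.2.le]
    have := h p p.2
    omega

theorem residualUpper_eq_zero_iff (g : Fin n → ℕ → ℕ → ℤ) (i : ℕ) {j : ℕ} (hj : 1 ≤ j) :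
    residualUpper g (i + 1) j = 0 ↔
      ∃ p < j, pot (multinodeSum g) i j ≤ pot (multinodeSum g) i p := by
  have h0 : 0 ≤ residualUpper g (i + 1) j := le_max_left _ _
  have h := (residualUpper_pos_iff g i hj).not
  push Not at h
  rw [← h]
  omega

theorem residualLower_eq_zero (g : Fin n → ℕ → ℕ → ℤ) (i : ℕ) {j q : ℕ} (hjq : j < q)
    (hq : q ≤ i + 2) (h : pot (multinodeSum g) i j ≤ pot (multinodeSum g) i q) :
    residualLower g (i + 1) j = 0 := by
  rw [residualLower, max_eq_left]
  refine (ciInf_le (Set.finite_range _).bddBelow (⟨q, hjq, hq⟩ : Set.Ioc j (i + 1 + 1))).trans ?_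
  rw [slackDiff_eq g i hjq.le]
  omega

/-- A positive residual upper slack marks a strict record of the potential. An active `j` is the
last record, hence the first maximizer; no smaller index separates, because the slack at `j` is
positive. -/
theorem isActive_iff {g : Fin n → ℕ → ℕ → ℤ} (hg : IsExtFeasible c g) (i j : ℕ) :
    IsActive g (i + 1) j ↔ 1 ≤ j ∧ IsFirstMax (pot (multinodeSum g) i) j := by
  constructor
  · rintro ⟨hj, hji, ⟨-, hsep⟩, -, hpos⟩
    rw [residualUpper_pos_iff g i hj] at hpos
    refine ⟨hj, hpos, ?_⟩
    have hle : ∀ q ≤ i + 2, pot (multinodeSum g) i q ≤ pot (multinodeSum g) i j := by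
      intro q
      induction q using Nat.strong_induction_on with
      | _ q ih =>
        intro hq
        rcases lt_trichotomy q j with h | rfl | h
        · exact (hpos q h).le
        · exact le_rfl
        · obtain ⟨p, hp, hp'⟩ := (residualUpper_eq_zero_iff g i (by omega)).1 (hsep q h hq)
          exact hp'.trans (ih p hp (by omega))
    intro q
    rcases le_total q (i + 2) with h | h
    · exact hle q h
    · exact hg.isPattern.pot_eq i q h ▸ hle (i + 2) le_rfl
  · rintro ⟨hj, hmax⟩
    have hji := hg.isPattern.pot_le_of_firstMax hmax
    have hpos := (residualUpper_pos_iff g i hj).2 hmax.1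
    refine ⟨hj, hji, ⟨fun r hr => ?_, fun r hr _ => ?_⟩, fun r hr hrj hsep => ?_, hpos⟩
    · exact residualLower_eq_zero g i hr (by omega) (hmax.2 r)
    · exact (residualUpper_eq_zero_iff g i (by omega)).2 ⟨j, hr, hmax.2 r⟩
    · exact hpos.ne' (hsep.2 j hrj (by omega))

theorem exists_isSwitchNode {g : Fin n → ℕ → ℕ → ℤ} {i j : ℕ}
    (h : ∃ k, ExtSwitchCondition g i j k) : ∃ k, IsSwitchNode g i j k := by
  obtain ⟨k, hk, hmin⟩ := wellFounded_lt.has_min {k | ExtSwitchCondition g i j k} h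
  exact ⟨k, hk, fun k' hlt hk' => hmin k' hk' hlt⟩

/-! ### The digraph in terms of patterns -/

/-- The pattern of a feasible function. -/
def toPattern (f : Feasible c) : ℕ → ℕ → ℤ := multinodeSum (extend c f.1)

theorem isExtFeasible (f : Feasible c) : IsExtFeasible c (extend c f.1) := f.2.isExtFeasible

theorem isPattern (f : Feasible c) : IsPattern c (toPattern f) := (isExtFeasible f).isPattern

theorem toPattern_injective : Function.Injective (toPattern (c := c)) := fun f f' h =>
  Subtype.ext (extend_injective c ((isExtFeasible f).eq_of_multinodeSum_eq (isExtFeasible f') h))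

theorem exists_toPattern_eq {x : ℕ → ℕ → ℤ} (hx : IsPattern c x) :
    ∃ f : Feasible c, toPattern f = x := by
  obtain ⟨g, hg, rfl⟩ := hx.exists_isExtFeasible
  obtain ⟨f, hf, rfl⟩ := hg.exists_isFeasible
  exact ⟨⟨f, hf⟩, rfl⟩

theorem exists_isMove {i j : ℕ} (hi : i < n) (f : Feasible c)
    (hj : IsActive (extend c f.1) (i + 1) j) :
    ∃ f' : Feasible c, IsMove (i + 1) (extend c f.1) (extend c f'.1) ∧
      toPattern f' = bump (toPattern f) (i + 1) j 1 := by
  have hg := isExtFeasible f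
  have hact := (isActive_iff hg i j).1 hj
  obtain ⟨l, rfl⟩ : ∃ l, j = l + 1 := ⟨j - 1, by omega⟩
  have hli := hg.isPattern.pot_le_of_firstMax hact.2
  obtain ⟨s, hs⟩ := exists_isSwitchNode (hg.switch (i + 1) (l + 1) (by omega) hli hi)
  obtain ⟨f', hf', heq⟩ := (hg.raise hi (by omega) hs (hact.2.1 l (by omega))
    (hact.2.2 _)).exists_isFeasible
  refine ⟨⟨f', hf'⟩, ⟨l + 1, s, hj, hs, fun k a b => ?_⟩, ?_⟩
  · rw [heq, raise]
  · exact (congrArg multinodeSum heq).trans (multinodeSum_raise _ _ _ _)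

/-- For the converse, the function produced by the move has the same pattern as `f'`, and patterns
determine feasible functions. -/
theorem crystal_edge_iff {i : Fin n} {f f' : Feasible c} :
    (crystal c).Edge i f f' ↔ Step i (toPattern f) (toPattern f') := by
  constructor
  · rintro ⟨j, s, hj, -, hf'⟩
    have hact := (isActive_iff (isExtFeasible f) i j).1 hj
    refine ⟨j, hact.1, hact.2, ?_⟩
    have : extend c f'.1 = raise (extend c f.1) s (i + 1) j :=
      funext fun k => funext fun a => funext fun b => hf' k a b
    rw [toPattern, this, multinodeSum_raise, toPattern]
  · rintro ⟨j, hj, hmax, heq⟩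
    obtain ⟨f'', hmove, hf''⟩ :=
      exists_isMove i.2 f ((isActive_iff (isExtFeasible f) i j).2 ⟨hj, hmax⟩)
    obtain rfl : f'' = f' := toPattern_injective (hf''.trans heq.symm)
    exact hmove

theorem exists_edge_out {i : Fin n} {f : Feasible c} {y : ℕ → ℕ → ℤ}
    (h : Step i (toPattern f) y) : ∃ f', toPattern f' = y ∧ (crystal c).Edge i f f' := by
  obtain ⟨f', rfl⟩ := exists_toPattern_eq (h.isPattern (isPattern f) i.2)
  exact ⟨f', rfl, crystal_edge_iff.2 h⟩

theorem exists_edge_in {i : Fin n} {f : Feasible c} {y : ℕ → ℕ → ℤ}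
    (h : Step i y (toPattern f)) : ∃ f', toPattern f' = y ∧ (crystal c).Edge i f' f := by
  obtain ⟨f', rfl⟩ := exists_toPattern_eq (h.isPattern_in (isPattern f) i.2)
  exact ⟨f', rfl, crystal_edge_iff.2 h⟩

theorem isHeight_crystal : (crystal c).IsHeight (fun i f => headHeight i (toPattern f))
    (fun i f => tailHeight i (toPattern f)) where
  unique_out h h' := toPattern_injective ((crystal_edge_iff.1 h).unique (crystal_edge_iff.1 h'))
  unique_in h h' := toPattern_injective ((crystal_edge_iff.1 h).unique_in (crystal_edge_iff.1 h'))
  head_edge {i u _} h := ((crystal_edge_iff.1 h).heights (isPattern u) i.2).1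
  head_pos {i u} h := by
    obtain ⟨y, hy⟩ := headHeight_pos (isPattern u) h
    obtain ⟨v, -, hv⟩ := exists_edge_out hy
    exact ⟨v, hv⟩
  tail_edge {i u _} h := ((crystal_edge_iff.1 h).heights (isPattern u) i.2).2
  tail_pos {i v} h := by
    obtain ⟨a, ha⟩ := tailHeight_pos (isPattern v) h
    obtain ⟨u, -, hu⟩ := exists_edge_in (back_step (isPattern v) i.2 ha).1
    exact ⟨u, hu⟩

/-! ### The axioms for patterns -/

section

variable {x y y' : ℕ → ℕ → ℤ} {i j : ℕ}

theorem heights_of_neighboring (hx : IsPattern c x) (hi : i < n)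
    (hij : j = i + 1 ∨ i = j + 1) (h : Step i x y) :
    (tailHeight j x = tailHeight j y + 1 ∧ headHeight j y = headHeight j x) ∨
      (tailHeight j y = tailHeight j x ∧ headHeight j y = headHeight j x + 1) := by
  obtain ⟨a, ha, h, rfl⟩ := h
  rcases hij with rfl | rfl
  · rcases heights_below hx hi ha h with ⟨h1, h2, -⟩ | ⟨h1, h2, -⟩
    · exact .inr ⟨h2, h1⟩
    · exact .inl ⟨h2, h1⟩
  · rcases heights_above hx hi ha h with ⟨h1, h2, -⟩ | ⟨h1, h2, -⟩
    · exact .inr ⟨h2, h1⟩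
    · exact .inl ⟨h2, h1⟩

theorem heights_of_far (hij : i + 1 < j ∨ j + 1 < i) (h : Step i x y) :
    headHeight j y = headHeight j x ∧ tailHeight j y = tailHeight j x := by
  obtain ⟨a, -, -, rfl⟩ := h
  have hpot : ∀ q, pot (bump x (i + 1) a 1) j q = pot x j q := fun q =>
    pot_bump_of_ne x (by omega) (by omega) (by omega) a 1 q
  rw [headHeight, headHeight, tailHeight, tailHeight, peak_congr hpot, hpot]
  exact ⟨rfl, rfl⟩

theorem headHeight_convex (hx : IsPattern c x) (hi : i < n) (hne : i ≠ j) (h1 : Step i x y)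
    (h2 : Step i y y') : 2 * headHeight j y ≤ headHeight j x + headHeight j y' := by
  by_cases hb : j = i + 1
  · exact hb ▸ convex_below hx hi h1 h2
  by_cases ha : i = j + 1
  · subst ha
    exact convex_above hx hi h1 h2
  · have h3 := heights_of_far (j := j) (by omega) h1
    have h4 := heights_of_far (j := j) (by omega) h2
    omega

theorem commute_forward (hx : IsPattern c x) (hi : i < n) (hj : j < n)
    (hij : j = i + 1 ∨ i = j + 1) (h : Step i x y) (h' : Step j x y')
    (hl : headHeight j y = headHeight j x) :
    headHeight i y' ≠ headHeight i x ∧ ∃ w, Step j y w ∧ Step i y' w := by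
  obtain ⟨a, ha, h, rfl⟩ := h
  obtain ⟨b, hb, h', rfl⟩ := h'
  rcases hij with rfl | rfl
  · rcases heights_below hx hi ha h with ⟨h1, -⟩ | ⟨-, -, h1⟩
    · omega
    obtain ⟨hba, k1, k2⟩ := commute_of_not_below hb h h' h1
    refine ⟨?_, _, ⟨b, hb, k1, rfl⟩, ⟨a, ha, k2, bump_comm _ _ _ _ _ _ _⟩⟩
    rcases heights_above hx hj hb h' with ⟨h2, -⟩ | ⟨-, -, h2⟩
    · omega
    · exact absurd (h2 a h.2) (not_lt.2 hba)
  · rcases heights_above hx hi ha h with ⟨h1, -⟩ | ⟨-, -, h1⟩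
    · omega
    obtain ⟨hba, k1, k2⟩ := commute_of_not_above ha h' h h1
    refine ⟨?_, _, ⟨b, hb, k2, rfl⟩, ⟨a, ha, k1, bump_comm _ _ _ _ _ _ _⟩⟩
    rcases heights_below hx hj hb h' with ⟨h2, -⟩ | ⟨-, -, h2⟩
    · omega
    · exact absurd (h2 a h.2) (not_le.2 hba)

theorem firstMax_of_bump {a : ℕ} (ha : 1 ≤ a) (h : IsLastMax (pot x i) a) :
    IsFirstMax (pot (bump x (i + 1) a (-1)) i) a ∧
      bump (bump x (i + 1) a (-1)) (i + 1) a 1 = x :=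
  ⟨isFirstMax_bump ha h, by simpa using bump_neg x (i + 1) a (-1)⟩

theorem commute_backward (hx : IsPattern c x) (hi : i < n) (hj : j < n)
    (hij : j = i + 1 ∨ i = j + 1) (hs : Step i y x) (hs' : Step j y' x)
    (hl : headHeight j x ≠ headHeight j y) :
    headHeight i x = headHeight i y' ∧ ∃ w, Step j w y ∧ Step i w y' := by
  have hy := hs.isPattern_in hx hi
  have hy' := hs'.isPattern_in hx hj
  obtain ⟨a, ha, h, rfl⟩ := step_iff.1 hs
  obtain ⟨b, hb, h', rfl⟩ := step_iff.1 hs'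
  obtain ⟨f1, e1⟩ := firstMax_of_bump ha h
  obtain ⟨f2, e2⟩ := firstMax_of_bump hb h'
  rcases hij with rfl | rfl
  · have k := heights_below hy hi ha f1
    rw [e1] at k
    rcases k with ⟨-, -, k⟩ | ⟨k, -⟩
    · obtain ⟨k1, k2, k3⟩ := commute_of_below hb h h' k
      refine ⟨?_, _, step_iff.2 ⟨b, hb, k2, rfl⟩,
        step_iff.2 ⟨a, ha, k3, bump_comm _ _ _ _ _ _ _⟩⟩
      have k4 := heights_above hy' hj hb f2
      rw [e2] at k4
      rcases k4 with ⟨-, -, q, hq, hmax⟩ | ⟨k4, -⟩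
      · exact absurd (k1 q hmax) (not_lt.2 hq)
      · exact k4
    · omega
  · have k := heights_above hy hi ha f1
    rw [e1] at k
    rcases k with ⟨-, -, k⟩ | ⟨k, -⟩
    · obtain ⟨k1, k2, k3⟩ := commute_of_above ha h' h k
      refine ⟨?_, _, step_iff.2 ⟨b, hb, k3, rfl⟩,
        step_iff.2 ⟨a, ha, k2, bump_comm _ _ _ _ _ _ _⟩⟩
      have k4 := heights_below hy' hj hb f2
      rw [e2] at k4
      rcases k4 with ⟨-, -, q, hq, hmax⟩ | ⟨k4, -⟩
      · exact absurd (k1 q hmax) (not_le.2 hq)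
      · exact k4
    · omega

theorem verma_of_step (hx : IsPattern c x) (hi : i + 1 < n) (h : Step i x y)
    (h' : Step (i + 1) x y') (hl : headHeight (i + 1) y ≠ headHeight (i + 1) x)
    (hl' : headHeight i y' ≠ headHeight i x) :
    ∃ z, (∃ x₁ x₂ x₃, Step i x x₁ ∧ Step (i + 1) x₁ x₂ ∧ Step (i + 1) x₂ x₃ ∧ Step i x₃ z) ∧
      (∃ y₁ y₂ y₃, Step (i + 1) x y₁ ∧ Step i y₁ y₂ ∧ Step i y₂ y₃ ∧ Step (i + 1) y₃ z) := by
  obtain ⟨a, ha, h, rfl⟩ := h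
  obtain ⟨b, hb, h', rfl⟩ := h'
  refine verma_forward ha hb h h' ?_ ?_
  · rcases heights_below hx (by omega) ha h with ⟨-, -, k⟩ | ⟨k, -⟩
    · exact k
    · omega
  · rcases heights_above hx hi hb h' with ⟨-, -, k⟩ | ⟨k, -⟩
    · exact k
    · omega

theorem verma_of_step_in (hx : IsPattern c x) (hi : i + 1 < n) (hs : Step i y x)
    (hs' : Step (i + 1) y' x) (hl : headHeight (i + 1) x = headHeight (i + 1) y)
    (hl' : headHeight i x = headHeight i y') :
    ∃ z, (∃ x₁ x₂ x₃, Step i x₁ x ∧ Step (i + 1) x₂ x₁ ∧ Step (i + 1) x₃ x₂ ∧ Step i z x₃) ∧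
      (∃ y₁ y₂ y₃, Step (i + 1) y₁ x ∧ Step i y₂ y₁ ∧ Step i y₃ y₂ ∧ Step (i + 1) z y₃) := by
  have hi' : i < n := by omega
  have hy := hs.isPattern_in hx hi'
  have hy' := hs'.isPattern_in hx hi
  obtain ⟨a, ha, h, rfl⟩ := step_iff.1 hs
  obtain ⟨b, hb, h', rfl⟩ := step_iff.1 hs'
  obtain ⟨f1, e1⟩ := firstMax_of_bump ha h
  obtain ⟨f2, e2⟩ := firstMax_of_bump hb h'
  refine verma_backward hx hi h h' (isMax_of_below ?_ ?_) (isMax_of_above hb ?_ ?_)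
  · obtain ⟨q, hq, -⟩ := hy.exists_firstMax (i + 1)
    exact ⟨q, hq.2⟩
  · have k := heights_below hy hi' ha f1
    rw [e1] at k
    rcases k with ⟨k, -⟩ | ⟨-, -, k⟩
    · omega
    · exact k
  · obtain ⟨q, hq, -⟩ := hy'.exists_firstMax i
    exact ⟨q, hq.2⟩
  · have k := heights_above hy' hi hb f2
    rw [e2] at k
    rcases k with ⟨k, -⟩ | ⟨-, -, k⟩
    · omega
    · exact k

/-- The move of color `i` (for `d = true`) or its inverse (for `d = false`), given by the first
or the last maximizer. -/
def PatternOp (i : ℕ) (d : Bool) (x y : ℕ → ℕ → ℤ) : Prop :=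
  ∃ a, 1 ≤ a ∧ (if d then IsFirstMax (pot x i) a else IsLastMax (pot x i) a) ∧
    y = bump x (i + 1) a (if d then 1 else -1)

theorem PatternOp.commute {d d' : Bool} (hij : i + 1 < j ∨ j + 1 < i) (h : PatternOp i d x y)
    (h' : PatternOp j d' x y') : ∃ w, PatternOp j d' y w ∧ PatternOp i d y' w := by
  obtain ⟨a, ha, h, rfl⟩ := h
  obtain ⟨b, hb, h', rfl⟩ := h'
  refine ⟨_, ⟨b, hb, ?_, rfl⟩, ⟨a, ha, ?_, bump_comm _ _ _ _ _ _ _⟩⟩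
  · rwa [show pot (bump x (i + 1) a _) j = pot x j from
      funext (pot_bump_of_ne x (by omega) (by omega) (by omega) a _)]
  · rwa [show pot (bump x (j + 1) b _) i = pot x i from
      funext (pot_bump_of_ne x (by omega) (by omega) (by omega) b _)]

end

theorem op_iff {i : Fin n} {d : Bool} {f f' : Feasible c} :
    (crystal c).Op i d f f' ↔ PatternOp i d (toPattern f) (toPattern f') := by
  cases d
  · simp only [ColoredDigraph.Op, crystal_edge_iff, step_iff, PatternOp]
    simp
  · simp only [ColoredDigraph.Op, crystal_edge_iff, Step, PatternOp]
    simp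

theorem exists_op {i : Fin n} {d : Bool} {f : Feasible c} {y : ℕ → ℕ → ℤ}
    (h : PatternOp i d (toPattern f) y) :
    ∃ f' : Feasible c, toPattern f' = y ∧ (crystal c).Op i d f f' := by
  cases d
  · obtain ⟨a, ha, h, rfl⟩ := h
    exact exists_edge_in (step_iff.2 ⟨a, ha, by simpa using h, by simp⟩)
  · obtain ⟨a, ha, h, rfl⟩ := h
    exact exists_edge_out ⟨a, ha, by simpa using h, by simp⟩

/-! ### The axioms for the crystal -/

theorem neighboring_iff {i j : Fin n} :
    ColoredDigraph.Neighboring i j ↔ ((j : ℕ) = i + 1 ∨ (i : ℕ) = j + 1) := by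
  rw [ColoredDigraph.Neighboring, abs_eq (by norm_num)]
  omega

theorem axiomA2 (c : Fin n → ℕ) : (crystal c).AxiomA2 := by
  intro i j hij
  have hne : (i : ℕ) ≠ j := fun h => hij (Fin.ext h)
  simp only [isHeight_crystal.headLen_eq, isHeight_crystal.tailLen_eq]
  refine ⟨fun u v h => ?_, fun u v w h h' => headHeight_convex (isPattern u) i.2 hne
    (crystal_edge_iff.1 h) (crystal_edge_iff.1 h')⟩
  have hs := crystal_edge_iff.1 h
  by_cases hn : (j : ℕ) = i + 1 ∨ (i : ℕ) = j + 1
  · have hA : CartanMatrix.A n i j = -1 := by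
      simp only [CartanMatrix.A, Matrix.of_apply, if_neg hij]
      rw [if_pos (by omega)]
    have := heights_of_neighboring (isPattern u) i.2 hn hs
    rw [hA]
    omega
  · have hA : CartanMatrix.A n i j = 0 := by
      simp only [CartanMatrix.A, Matrix.of_apply, if_neg hij]
      rw [if_neg (by omega)]
    have := heights_of_far (j := j) (by omega) hs
    rw [hA]
    omega

theorem crystal_label_eq_zero_iff {i j : Fin n} (hij : ColoredDigraph.Neighboring i j)
    {u v : Feasible c} (h : (crystal c).Edge i u v) :
    (crystal c).label i j u v = 0 ↔ headHeight j (toPattern v) = headHeight j (toPattern u) := by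
  rw [neighboring_iff] at hij
  exact isHeight_crystal.label_eq_zero_iff
    (fun u v h => heights_of_neighboring (isPattern u) i.2 hij (crystal_edge_iff.1 h))
    (fun u v w h h' => headHeight_convex (isPattern u) i.2 (by omega) (crystal_edge_iff.1 h)
      (crystal_edge_iff.1 h')) h

theorem label_eq_one_iff {V : Type*} {K : ColoredDigraph n V} {i j : Fin n} {u v : V} :
    K.label i j u v = 1 ↔ K.label i j u v ≠ 0 := by
  unfold ColoredDigraph.label
  split_ifs <;> simp

theorem axiomA3 (c : Fin n → ℕ) : (crystal c).AxiomA3 := by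
  intro i j hij
  have hij' := neighboring_iff.1 hij
  have hji : ColoredDigraph.Neighboring j i := neighboring_iff.2 hij'.symm
  refine ⟨fun u v v' h h' hl => ?_, fun v u u' h h' hl => ?_⟩
  · rw [crystal_label_eq_zero_iff hij h] at hl
    obtain ⟨h1, w, h2, h3⟩ := commute_forward (isPattern u) i.2 j.2 hij' (crystal_edge_iff.1 h)
      (crystal_edge_iff.1 h') hl
    obtain ⟨w, rfl, hw⟩ := exists_edge_out h2
    rw [label_eq_one_iff, Ne, crystal_label_eq_zero_iff hji h']
    exact ⟨h1, ⟨v, h⟩, ⟨v', h'⟩, w, ⟨v', h', crystal_edge_iff.2 h3⟩, ⟨v, h, hw⟩⟩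
  · rw [label_eq_one_iff, Ne, crystal_label_eq_zero_iff hij h] at hl
    obtain ⟨h1, w, h2, h3⟩ := commute_backward (isPattern v) i.2 j.2 hij' (crystal_edge_iff.1 h)
      (crystal_edge_iff.1 h') hl
    obtain ⟨w, rfl, hw⟩ := exists_edge_in h2
    rw [crystal_label_eq_zero_iff hji h']
    exact ⟨h1, ⟨u, h⟩, ⟨u', h'⟩, w, ⟨u', h', crystal_edge_iff.2 h3⟩, ⟨u, h, hw⟩⟩

theorem vermaAt_comm {V : Type*} {K : ColoredDigraph n V} {i j : Fin n} {d : Bool} {v : V}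
    (h : K.VermaAt i j d v) : K.VermaAt j i d v := by
  obtain ⟨w, h1, h2⟩ := h
  exact ⟨w, h2, h1⟩

theorem vermaAt_forward {i j : Fin n} (hij : (j : ℕ) = i + 1) {u v v' : Feasible c}
    (h : (crystal c).Edge i u v) (h' : (crystal c).Edge j u v')
    (hl : (crystal c).label i j u v = 1) (hl' : (crystal c).label j i u v' = 1) :
    (crystal c).VermaAt i j true u := by
  rw [label_eq_one_iff, Ne, crystal_label_eq_zero_iff (neighboring_iff.2 (.inl hij)) h] at hl
  rw [label_eq_one_iff, Ne, crystal_label_eq_zero_iff (neighboring_iff.2 (.inr hij)) h'] at hl'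
  have hs := crystal_edge_iff.1 h
  have hs' := crystal_edge_iff.1 h'
  rw [hij] at hs' hl
  obtain ⟨z, ⟨x₁, x₂, x₃, p1, p2, p3, p4⟩, ⟨y₁, y₂, y₃, q1, q2, q3, q4⟩⟩ :=
    verma_of_step (isPattern u) (hij ▸ j.2) hs hs' hl hl'
  rw [← hij] at p2 p3 q1 q4
  obtain ⟨u₁, rfl, s1⟩ := exists_edge_out p1
  obtain ⟨u₂, rfl, s2⟩ := exists_edge_out p2
  obtain ⟨u₃, rfl, s3⟩ := exists_edge_out p3
  obtain ⟨w, rfl, s4⟩ := exists_edge_out p4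
  obtain ⟨v₁, rfl, t1⟩ := exists_edge_out q1
  obtain ⟨v₂, rfl, t2⟩ := exists_edge_out q2
  obtain ⟨v₃, rfl, t3⟩ := exists_edge_out q3
  exact ⟨w, ⟨u₁, s1, u₂, s2, u₃, s3, s4⟩, ⟨v₁, t1, v₂, t2, v₃, t3, crystal_edge_iff.2 q4⟩⟩

theorem vermaAt_backward {i j : Fin n} (hij : (j : ℕ) = i + 1) {v u u' : Feasible c}
    (h : (crystal c).Edge i u v) (h' : (crystal c).Edge j u' v)
    (hl : (crystal c).label i j u v = 0) (hl' : (crystal c).label j i u' v = 0) :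
    (crystal c).VermaAt i j false v := by
  rw [crystal_label_eq_zero_iff (neighboring_iff.2 (.inl hij)) h] at hl
  rw [crystal_label_eq_zero_iff (neighboring_iff.2 (.inr hij)) h'] at hl'
  have hs := crystal_edge_iff.1 h
  have hs' := crystal_edge_iff.1 h'
  rw [hij] at hs' hl
  obtain ⟨z, ⟨x₁, x₂, x₃, p1, p2, p3, p4⟩, ⟨y₁, y₂, y₃, q1, q2, q3, q4⟩⟩ :=
    verma_of_step_in (isPattern v) (hij ▸ j.2) hs hs' hl hl'
  rw [← hij] at p2 p3 q1 q4
  obtain ⟨u₁, rfl, s1⟩ := exists_edge_in p1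
  obtain ⟨u₂, rfl, s2⟩ := exists_edge_in p2
  obtain ⟨u₃, rfl, s3⟩ := exists_edge_in p3
  obtain ⟨w, rfl, s4⟩ := exists_edge_in p4
  obtain ⟨v₁, rfl, t1⟩ := exists_edge_in q1
  obtain ⟨v₂, rfl, t2⟩ := exists_edge_in q2
  obtain ⟨v₃, rfl, t3⟩ := exists_edge_in q3
  exact ⟨w, ⟨u₁, s1, u₂, s2, u₃, s3, s4⟩, ⟨v₁, t1, v₂, t2, v₃, t3, crystal_edge_iff.2 q4⟩⟩

theorem axiomA4 (c : Fin n → ℕ) : (crystal c).AxiomA4 := by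
  intro i j hij
  rcases neighboring_iff.1 hij with h | h
  · exact ⟨fun _ _ _ h1 h2 h3 h4 => vermaAt_forward h h1 h2 h3 h4,
      fun _ _ _ h1 h2 h3 h4 => vermaAt_backward h h1 h2 h3 h4⟩
  · exact ⟨fun _ _ _ h1 h2 h3 h4 => vermaAt_comm (vermaAt_forward h h2 h1 h4 h3),
      fun _ _ _ h1 h2 h3 h4 => vermaAt_comm (vermaAt_backward h h2 h1 h4 h3)⟩

theorem axiomA5 (c : Fin n → ℕ) : (crystal c).AxiomA5 := by
  rintro i j hij d d' v ⟨x, hx⟩ ⟨y, hy⟩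
  have hij' : (i : ℕ) + 1 < j ∨ (j : ℕ) + 1 < i := by
    rcases le_abs.1 hij with h | h <;> omega
  obtain ⟨w, h1, h2⟩ := (op_iff.1 hx).commute hij' (op_iff.1 hy)
  obtain ⟨w, rfl, hw⟩ := exists_op h1
  exact ⟨⟨x, hx⟩, ⟨y, hy⟩, w, ⟨y, hy, op_iff.2 h2⟩, ⟨x, hx, hw⟩⟩

/-! ### Connectedness -/

theorem IsPattern.le_left {x : ℕ → ℕ → ℤ} (hx : IsPattern c x) (i j : ℕ) : x i j ≤ x 0 0 := by
  induction j generalizing i with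
  | zero => exact (hx.left_eq i 0).le
  | succ j ih =>
    cases i with
    | zero =>
      rw [hx.eq_zero (Nat.succ_pos j), ← hx.eq_zero (Nat.zero_lt_one)]
      exact (hx.up 0 1).trans (hx.down 0 0)
    | succ i => exact (hx.down i j).trans (ih i)

/-- The total amount by which the entries of a pattern can still grow. -/
def room (n : ℕ) (x : ℕ → ℕ → ℤ) : ℤ :=
  ∑ p ∈ Finset.range (n + 1) ×ˢ Finset.range (n + 1), (x 0 0 - x p.1 p.2)

theorem IsPattern.room_nonneg {x : ℕ → ℕ → ℤ} (hx : IsPattern c x) : 0 ≤ room n x :=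
  Finset.sum_nonneg fun _ _ => sub_nonneg.2 (hx.le_left _ _)

theorem Step.room_lt {i : ℕ} (hi : i < n) {x y : ℕ → ℕ → ℤ} (hx : IsPattern c x)
    (h : Step i x y) : room n y < room n x := by
  obtain ⟨j, hj, h, rfl⟩ := h
  have hji := hx.pot_le_of_firstMax h
  refine Finset.sum_lt_sum (fun p _ => ?_) ⟨(i + 1, j), ?_, ?_⟩
  · simp only [bump]
    split_ifs <;> omega
  · simp only [Finset.mem_product, Finset.mem_range]
    omega
  · simp [bump]

/-- A pattern to which no move is applicable is determined by its boundary values. -/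
theorem IsPattern.succ_eq_of_pot_nonpos {x : ℕ → ℕ → ℤ} (hx : IsPattern c x)
    (h : ∀ i < n, ∀ q, pot x i q ≤ 0) (q : ℕ) : ∀ i, q ≤ i → i ≤ n → x (i + 1) q = x i q := by
  induction q using Nat.strong_induction_on with
  | _ q ih =>
    intro i hqi hin
    cases q with
    | zero => exact hx.left_eq _ _
    | succ q =>
      obtain ⟨i, rfl⟩ : ∃ l, i = l + 1 := ⟨i - 1, by omega⟩
      have h1 := h i (by omega) (q + 1)
      have h2 : x (i + 1 + 1) (q + 1) - x (i + 1) (q + 1) ≤ pot x i (q + 1) := by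
        rw [pot]
        -- By induction the earlier columns agree in rows `i` and `i + 1`, so the potential is a sum
        -- of nonnegative differences; being at most 0, it forces the last one to vanish.
        have h3 : ∀ r ∈ Finset.range (q + 1), x i r - x (i + 1) (r + 1) - x (i + 1) r
            + x (i + 2) (r + 1) = x (i + 1 + 1) (r + 1) - x (i + 1) (r + 1) := by
          intro r hr
          have := ih r (by simpa using hr) i (by simp at hr; omega) (by omega)
          have h7 : i + 1 + 1 = i + 2 := rfl
          rw [h7]
          omega
        rw [Finset.sum_congr rfl h3]
        exact Finset.single_le_sum (f := fun r => x (i + 1 + 1) (r + 1) - x (i + 1) (r + 1))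
          (fun r _ => sub_nonneg.2 (hx.up _ _)) (by simp)
      have h4 := hx.up (i + 1) (q + 1)
      omega

theorem IsPattern.eq_of_pot_nonpos {x y : ℕ → ℕ → ℤ} (hx : IsPattern c x) (hy : IsPattern c y)
    (h : ∀ i < n, ∀ q, pot x i q ≤ 0) (h' : ∀ i < n, ∀ q, pot y i q ≤ 0) : x = y := by
  have key : ∀ d i j, n + 1 ≤ i + d → x i j = y i j := by
    intro d
    induction d with
    | zero =>
      intro i j hi
      rw [hx.boundary i j (by omega), hy.boundary i j (by omega)]
    | succ d ih =>
      intro i j hi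
      by_cases hb : j = 0 ∨ i < j ∨ n < i
      · rw [hx.boundary i j hb, hy.boundary i j hb]
      · rw [← hx.succ_eq_of_pot_nonpos h j i (by omega) (by omega),
          ← hy.succ_eq_of_pot_nonpos h' j i (by omega) (by omega), ih (i + 1) j (by omega)]
  funext i j
  exact key (n + 1) i j (by omega)

/-- A positive potential value means that a move applies, and each move lowers the nonnegative
`room`. -/
theorem exists_sink (m : ℕ) : ∀ f : Feasible c, (room n (toPattern f)).toNat ≤ m →
    ∃ s : Feasible c, Relation.EqvGen (fun a b => ∃ i, (crystal c).Edge i a b) f s ∧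
      ∀ i < n, ∀ q, pot (toPattern s) i q ≤ 0 := by
  induction m using Nat.strong_induction_on with
  | _ m ih =>
    intro f hf
    by_cases h : ∀ i < n, ∀ q, pot (toPattern f) i q ≤ 0
    · exact ⟨f, .refl f, h⟩
    push Not at h
    obtain ⟨i, hi, q, hq⟩ := h
    obtain ⟨a, ha, -⟩ := (isPattern f).exists_firstMax i
    have h1 : 0 < headHeight i (toPattern f) := by
      have h2 := headHeight_eq (isPattern f) ha.2
      have h3 := ha.2 q
      omega
    obtain ⟨y, hy⟩ := headHeight_pos (isPattern f) h1
    obtain ⟨f', rfl, hf'⟩ := exists_edge_out (i := ⟨i, hi⟩) hy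
    have h4 := hy.room_lt hi (isPattern f)
    have h5 := (isPattern f').room_nonneg
    obtain ⟨s, hs, hs'⟩ := ih (m - 1) (by omega) f' (by omega)
    exact ⟨s, .trans _ _ _ (.rel _ _ ⟨_, hf'⟩) hs, hs'⟩

theorem isPattern_boundarySum (c : Fin n → ℕ) : IsPattern c (boundarySum c) := by
  refine ⟨fun _ _ _ => rfl, fun i j => ?_, fun i j => ?_⟩ <;>
    refine Finset.sum_le_sum fun k _ => ?_ <;> split_ifs <;> grind

theorem crystal_connected (c : Fin n → ℕ) : (crystal c).Connected := by
  refine ⟨?_, fun u v => ?_⟩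
  · obtain ⟨f, -⟩ := exists_toPattern_eq (isPattern_boundarySum c)
    exact ⟨f⟩
  · obtain ⟨s, hs, hs'⟩ := exists_sink _ u le_rfl
    obtain ⟨t, ht, ht'⟩ := exists_sink _ v le_rfl
    obtain rfl : s = t :=
      toPattern_injective ((isPattern s).eq_of_pot_nonpos (isPattern t) hs' ht')
    exact hs.trans _ _ _ ht.symm

theorem isRANCrystal_crystal (c : Fin n → ℕ) : (crystal c).IsRANCrystal where
  connected := crystal_connected c
  a1 := isHeight_crystal.axiomA1
  a2 := axiomA2 c
  a3 := axiomA3 c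
  a4 := axiomA4 c
  a5 := axiomA5 c

end CrossingModel

theorem mainTheorem2 (n : ℕ) (c : Fin n → ℕ) :
    (∀ (i : Fin n) (f : CrossingModel.Feasible c),
      CrossingModel.MoveApplicable ((i : ℕ) + 1) (CrossingModel.extend c f.1) →
      ∃ f' : CrossingModel.Feasible c,
        CrossingModel.IsMove ((i : ℕ) + 1) (CrossingModel.extend c f.1)
          (CrossingModel.extend c f'.1)) ∧
    (CrossingModel.crystal c).IsRANCrystal := by
  refine ⟨fun i f ⟨j, hj⟩ => ?_, CrossingModel.isRANCrystal_crystal c⟩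
  obtain ⟨f', hf', -⟩ := CrossingModel.exists_isMove i.2 f hj
  exact ⟨f', hf'⟩
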